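/- Let $0\le m\le n$ be integers and let $0<\lambda_1<\lambda_2<\cdots<\lambda_n$ be real numbers. Let $M$ be the space of real $m\times n$ matrices $X=(x_{\alpha k})$ of rank $m$, and let $G_{n,m}(\mathbb{R})=M/GL(m,\mathbb{R})$ be the real Grassmann manifold, with the quotient topology. For a multi-index $1\le i_1<\cdots<i_m\le n$ with complement $k_1<\cdots<k_{n-m}$, let $\widetilde U_{i_1\cdots i_m}$ be the set of classes of matrices whose columns $i_1,\dots,i_m$ form the identity matrix $I_m$; it is a chart domain whose coordinates are the entries of the $m\times(n-m)$ matrix $Z$ formed by the remaining columns $k_1,\dots,k_{n-m}$. Let $O_{i_1\cdots i_m}$ be the point of $\widetilde U_{i_1\cdots i_m}$ with $Z=0$. Let $f:G_{n,m}(\mathbb{R})\to\mathbb{R}$ be the function $$f([X])=\frac{\det\left(XX^{T}\right)}{\det\left(X\,\mathrm{diag}(\lambda_1^{-2},\dots,\lambda_n^{-2})\,X^{T}\right)},$$ and equip $G_{n,m}(\mathbb{R})$ with the Riemannian metric given in each of the above charts by $$g=\mathrm{tr}\left[(I+ZZ^{T})^{-1}\,dZ\,(I+Z^{T}Z)^{-1}\,dZ^{T}\right].$$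 The critical points of $f$ are the points $O_{i_1\cdots i_m}$; write $\mathrm{ind}$ for the Morse index of $f$ at a critical point, i.e. the largest dimension of a subspace on which the Hessian of $f$ there is negative definite. A trajectory from a critical point $p$ to a critical point $q$ is the orbit $\varphi(\mathbb{R})$ of a solution $\varphi:\mathbb{R}\to G_{n,m}(\mathbb{R})$ of $\dot x=-\nabla f$ with $\lim_{t\to-\infty}\varphi(t)=p$ and $\lim_{t\to+\infty}\varphi(t)=q$. Let $O_{i_1\cdots i_m}$ and $O_{l_1\cdots l_m}$ be two critical points with $$\mathrm{ind}(O_{i_1\cdots i_m})-\mathrm{ind}(O_{l_1\cdots l_m})=1.$$ Then the number $\Gamma(O_{i_1\cdots i_m},O_{l_1\cdots l_m})$ of trajectories from $O_{i_1\cdots i_m}$ to $O_{l_1\cdots l_m}$ is $$\Gamma(O_{i_1\cdots i_m},O_{l_1\cdots l_m})=\begin{cases}2,&\text{if there is } k\in\{1,\dots,m\}\text{ with } i_k=l_k+1 \text{ and } i_j=l_j\text{ for all }j\ne k,\\ 0,&\text{otherwise.}\end{cases}$$ -/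

import Mathlib

open Filter Topology

noncomputable section

namespace RealGrassmann

/-- The space `M` of real `m × n` matrices of rank `m`. -/
abbrev FullRank (m n : ℕ) : Type :=
  {X : Matrix (Fin m) (Fin n) ℝ // X.rank = m}

/-- Two matrices of `M` are equivalent when they differ by left multiplication by an element of
`GL(m, ℝ)`. -/
def grSetoid (m n : ℕ) : Setoid (FullRank m n) where
  r X Y := ∃ A : GL (Fin m) ℝ, Y.1 = (A : Matrix (Fin m) (Fin m) ℝ) * X.1
  iseqv :=
    { refl := fun X => ⟨1, by simp⟩
      symm := by
        rintro X Y ⟨A, h⟩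
        refine ⟨A⁻¹, ?_⟩
        rw [h, ← Matrix.mul_assoc, ← Units.val_mul]
        simp
      trans := by
        rintro X Y Z ⟨A, h⟩ ⟨B, k⟩
        refine ⟨B * A, ?_⟩
        rw [k, h, Units.val_mul, Matrix.mul_assoc] }

/-- The real Grassmann manifold `G_{n,m}(ℝ) = M / GL(m, ℝ)`. -/
def Gr (m n : ℕ) : Type := Quotient (grSetoid m n)

/-- The quotient topology. -/
instance (m n : ℕ) : TopologicalSpace (Gr m n) :=
  inferInstanceAs (TopologicalSpace (Quotient (grSetoid m n)))

/-- The projection `π : M → G_{n,m}(ℝ)`. -/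
def proj {m n : ℕ} (X : FullRank m n) : Gr m n := Quotient.mk (grSetoid m n) X

/-! ### Charts -/

/-- The column indices `k` that do not occur in the multi-index `i`. -/
abbrev Compl {m n : ℕ} (i : Fin m ↪o Fin n) : Type := {k : Fin n // k ∉ Set.range i}

/-- The coordinate space `ℝ^{m(n-m)}` of the chart with multi-index `i`. -/
abbrev Coord {m n : ℕ} (i : Fin m ↪o Fin n) : Type := Fin m → Compl i → ℝ

open Classical in
/-- The matrix whose columns `i_1, …, i_m` form the identity matrix and whose other columns are
those of `Z`. -/
def chartMatrix {m n : ℕ} (i : Fin m ↪o Fin n) (Z : Coord i) : Matrix (Fin m) (Fin n) ℝ :=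
  Matrix.of fun α k =>
    if h : k ∈ Set.range i then (if i α = k then 1 else 0) else Z α ⟨k, h⟩

theorem chartMatrix_submatrix {m n : ℕ} (i : Fin m ↪o Fin n) (Z : Coord i) :
    (chartMatrix i Z).submatrix id i = 1 := by
  ext α β
  simp [chartMatrix, Matrix.one_apply]

theorem chartMatrix_rank {m n : ℕ} (i : Fin m ↪o Fin n) (Z : Coord i) :
    (chartMatrix i Z).rank = m := by
  apply le_antisymm
  · simpa using (chartMatrix i Z).rank_le_height
  · have h := Matrix.rank_mul_le_left (chartMatrix i Z)
      ((1 : Matrix (Fin n) (Fin n) ℝ).submatrix id i)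
    have e : chartMatrix i Z * (1 : Matrix (Fin n) (Fin n) ℝ).submatrix id i = 1 := by
      rw [← chartMatrix_submatrix i Z]
      ext α β
      simp [Matrix.mul_apply, Matrix.one_apply]
    rw [e, Matrix.rank_one] at h
    simpa using h

/-- The inverse chart map `ℝ^{m(n-m)} → G_{n,m}(ℝ)`. -/
def chartInv {m n : ℕ} (i : Fin m ↪o Fin n) (Z : Coord i) : Gr m n :=
  proj ⟨chartMatrix i Z, chartMatrix_rank i Z⟩

/-- The chart domain. -/
def chartDomain {m n : ℕ} (i : Fin m ↪o Fin n) : Set (Gr m n) := Set.range (chartInv i)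

/-- The chart map: on the chart domain, the class of `X` is sent to the remaining columns of
`X_i⁻¹ X`, where `X_i` consists of the columns `i_1, …, i_m`. (Meaningless off the domain.) -/
def chart {m n : ℕ} (i : Fin m ↪o Fin n) : Gr m n → Coord i :=
  Quotient.lift
    (fun (X : FullRank m n) (α : Fin m) (k : Compl i) =>
      ((X.1.submatrix id i)⁻¹ * X.1.submatrix id (Subtype.val : Compl i → Fin n)) α k)
    (by
      rintro X Y ⟨A, h⟩
      have hA : IsUnit (A : Matrix (Fin m) (Fin m) ℝ).det :=
        (Matrix.isUnit_iff_isUnit_det _).1 A.isUnit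
      have e : ∀ {κ : Type} (c : κ → Fin n),
          Y.1.submatrix id c = (A : Matrix (Fin m) (Fin m) ℝ) * X.1.submatrix id c := by
        intro κ c
        ext a b
        simp [h, Matrix.mul_apply]
      funext α k
      rw [e i, e (Subtype.val : Compl i → Fin n), Matrix.mul_inv_rev, Matrix.mul_assoc,
        Matrix.nonsing_inv_mul_cancel_left _ _ hA])

/-- The point `O_{i_1 ⋯ i_m}`, the origin of the chart with multi-index `i`. -/
def origin {m n : ℕ} (i : Fin m ↪o Fin n) : Gr m n := chartInv i 0

/-! ### The function and the metric -/

/-- `Δ`, the Gram determinant of the rows `ξ_1, …, ξ_m` of `X`. -/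
def gramDet {m n : ℕ} (X : Matrix (Fin m) (Fin n) ℝ) : ℝ := (X * X.transpose).det

/-- The matrix with rows `(x_{α1}/λ_1, …, x_{αn}/λ_n)`. -/
def rescale {m n : ℕ} (lam : Fin n → ℝ) (X : Matrix (Fin m) (Fin n) ℝ) :
    Matrix (Fin m) (Fin n) ℝ :=
  Matrix.of fun α k => X α k / lam k

theorem rescale_mul {m n : ℕ} (lam : Fin n → ℝ) (A : Matrix (Fin m) (Fin m) ℝ)
    (X : Matrix (Fin m) (Fin n) ℝ) : rescale lam (A * X) = A * rescale lam X := by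
  ext α k
  simp [rescale, Matrix.mul_apply, Finset.sum_div, mul_div_assoc]

theorem gramDet_mul {m n : ℕ} (A : Matrix (Fin m) (Fin m) ℝ) (X : Matrix (Fin m) (Fin n) ℝ) :
    gramDet (A * X) = A.det ^ 2 * gramDet X := by
  have h : A * X * (A * X).transpose = A * (X * X.transpose) * A.transpose := by
    simp only [Matrix.transpose_mul, Matrix.mul_assoc]
  rw [gramDet, gramDet, h, Matrix.det_mul, Matrix.det_mul, Matrix.det_transpose]
  ring

/-- The function `f = Δ / Δ̄` on `G_{n,m}(ℝ)`, where `Δ̄` is the Gram determinant of the rescaled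
rows. -/
def morseFun {m n : ℕ} (lam : Fin n → ℝ) : Gr m n → ℝ :=
  Quotient.lift (fun X : FullRank m n => gramDet X.1 / gramDet (rescale lam X.1))
    (by
      rintro X Y ⟨A, h⟩
      have hA : IsUnit (A : Matrix (Fin m) (Fin m) ℝ).det :=
        (Matrix.isUnit_iff_isUnit_det _).1 A.isUnit
      rw [h, rescale_mul, gramDet_mul, gramDet_mul,
        mul_div_mul_left _ _ (pow_ne_zero 2 hA.ne_zero)])

/-- The function `f` in the coordinates of the chart with multi-index `i`. -/
def localFun {m n : ℕ} (lam : Fin n → ℝ) (i : Fin m ↪o Fin n) (Z : Coord i) : ℝ :=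
  morseFun lam (chartInv i Z)

/-- The Riemannian metric `tr[(I + ZZᵀ)⁻¹ dZ (I + ZᵀZ)⁻¹ dZᵀ]` in the coordinates of the chart
with multi-index `i`, as a bilinear form at the point `Z`. -/
def metric {m n : ℕ} (i : Fin m ↪o Fin n) (Z V W : Coord i) : ℝ :=
  ((1 + Matrix.of Z * (Matrix.of Z).transpose)⁻¹ * Matrix.of V *
    (1 + (Matrix.of Z).transpose * Matrix.of Z)⁻¹ * (Matrix.of W).transpose).trace

/-- `W` is the coordinate expression of `-∇f` at the point `Z`: `g(W, V) = -V f` for all `V`. -/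
def IsNegGrad {m n : ℕ} (lam : Fin n → ℝ) (i : Fin m ↪o Fin n) (Z W : Coord i) : Prop :=
  ∀ V : Coord i, metric i Z W V = -(fderiv ℝ (localFun lam i) Z V)

/-! ### Morse index -/

/-- The Morse index of `f` at the point `p`, computed in the chart with multi-index `i` (whose
domain should contain `p`): the largest dimension of a linear subspace of the coordinate space on
which the Hessian of `f` is negative definite. -/
def morseIndex {m n : ℕ} (lam : Fin n → ℝ) (i : Fin m ↪o Fin n) (p : Gr m n) : ℕ :=
  sSup {r : ℕ | ∃ E : Submodule ℝ (Coord i), Module.finrank ℝ E = r ∧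
    ∀ v ∈ E, v ≠ 0 → fderiv ℝ (fderiv ℝ (localFun lam i)) (chart i p) v v < 0}

/-! ### Trajectories -/

/-- `γ` is a solution, defined for all times, of `ẋ = -∇f` on `G_{n,m}(ℝ)`. -/
def IsFlowLine {m n : ℕ} (lam : Fin n → ℝ) (γ : ℝ → Gr m n) : Prop :=
  Continuous γ ∧ ∀ (t : ℝ) (i : Fin m ↪o Fin n), γ t ∈ chartDomain i →
    ∃ W : Coord i, IsNegGrad lam i (chart i (γ t)) W ∧
      HasDerivAt (fun s => chart i (γ s)) W t

/-- The trajectories (unparametrized orbits) of `ẋ = -∇f` that go from `p` to `q`. -/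
def trajectories {m n : ℕ} (lam : Fin n → ℝ) (p q : Gr m n) : Set (Set (Gr m n)) :=
  {C | ∃ γ : ℝ → Gr m n, IsFlowLine lam γ ∧ Tendsto γ atBot (𝓝 p) ∧ Tendsto γ atTop (𝓝 q) ∧
    C = Set.range γ}

end RealGrassmann

end

noncomputable section

namespace RealGrassmann

/-! ### Calculus of matrix-valued curves -/

/-! Identify a class `[X]` with the orthogonal projection `P` onto the row space of `X`, and write
`d k = λ_k⁻²`, which decreases in `k`. The flow is controlled by the traces `T_g = tr (P diag(g))`
(`trFun`). In a basis of the row space diagonalising both Gram matrices, the derivative of `T_g`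
along `-∇f` is `4 f` times a sum of terms `(E[gd] - E[g] E[d]) / E[d]`, each `E` being a mean over
the squared entries of a unit row. By Chebyshev's inequality, `T_g` is therefore nondecreasing
whenever `g` is decreasing (`flowRate_nonneg`).

Take for `g` the indicator of the first `c` indices. At `O_i` the trace counts the `α` with `i α <
c`, so a flow line from `O_i` to `O_l` forces `l α ≤ i α` for every `α`
(`IsFlowLine.le_of_tendsto`). The Hessian at `O_i` is diagonal and its index is `∑ (i α - α)`,
indices counted from zero (`morseIndex_origin`). Index difference one then means that exactly one
entry drops, by one (`exists_eq_add_one_of_sum`); otherwise there is no trajectory.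

For such neighbours all these traces but one agree at the two ends, hence are constant along the
flow line. This freezes all diagonal entries of `P` except two, whose sum is 1. As `P` is symmetric
and idempotent, a diagonal entry 0 or 1 kills the rest of its row, so the flow line stays on one
coordinate axis of the chart `i` (`exists_eq_axis`). The estimate `|T_g'| ≤ K T_g` for `g ≥ 0`
prevents it from reaching either end of a half axis in finite time, so its orbit is one of the two
half axes (`IsFlowLine.range_eq_arc`). Conversely, on a half axis the gradient equation is a scalar
equation with a global solution (`exists_flowLine_arc`).

Computations are made on matrices `X`, where a velocity matters only up to a gauge term `H * X`:
such a term is tangent to the `GL(m)` orbit and is annihilated by `1 - P`. -/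

/-- Entrywise derivative of a curve of matrices. -/
def HasMatDeriv {a b : Type*} (M : ℝ → Matrix a b ℝ) (M' : Matrix a b ℝ) (t : ℝ) : Prop :=
  ∀ i j, HasDerivAt (fun s => M s i j) (M' i j) t

namespace HasMatDeriv

variable {a b c : Type*} {t : ℝ}

theorem const (A : Matrix a b ℝ) : HasMatDeriv (fun _ => A) 0 t :=
  fun i j => by simpa using hasDerivAt_const t (A i j)

theorem add {M N : ℝ → Matrix a b ℝ} {M' N' : Matrix a b ℝ} (hM : HasMatDeriv M M' t)
    (hN : HasMatDeriv N N' t) : HasMatDeriv (fun s => M s + N s) (M' + N') t :=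
  fun i j => (hM i j).add (hN i j)

theorem transpose {M : ℝ → Matrix a b ℝ} {M' : Matrix a b ℝ} (hM : HasMatDeriv M M' t) :
    HasMatDeriv (fun s => (M s).transpose) M'.transpose t :=
  fun i j => hM j i

theorem mul [Fintype b] {M : ℝ → Matrix a b ℝ} {N : ℝ → Matrix b c ℝ} {M' : Matrix a b ℝ}
    {N' : Matrix b c ℝ} (hM : HasMatDeriv M M' t) (hN : HasMatDeriv N N' t) :
    HasMatDeriv (fun s => M s * N s) (M' * N t + M t * N') t := by
  intro i j
  simp only [Matrix.mul_apply, Matrix.add_apply, ← Finset.sum_add_distrib]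
  exact HasDerivAt.fun_sum fun k _ => (hM i k).mul (hN k j)

theorem mul_const [Fintype b] {M : ℝ → Matrix a b ℝ} {M' : Matrix a b ℝ}
    (hM : HasMatDeriv M M' t) (N : Matrix b c ℝ) : HasMatDeriv (fun s => M s * N) (M' * N) t := by
  simpa using hM.mul (const N)

theorem unique {M : ℝ → Matrix a b ℝ} {M' N' : Matrix a b ℝ} (h : HasMatDeriv M M' t)
    (h' : HasMatDeriv M N' t) : M' = N' := by
  ext i j
  exact (h i j).unique (h' i j)

theorem congr {M N : ℝ → Matrix a b ℝ} {M' : Matrix a b ℝ} (h : HasMatDeriv M M' t)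
    (e : ∀ᶠ s in 𝓝 t, N s = M s) : HasMatDeriv N M' t :=
  fun i j => (h i j).congr_of_eventuallyEq (e.mono fun s hs => by simp only [hs])

theorem trace [Fintype a] {M : ℝ → Matrix a a ℝ} {M' : Matrix a a ℝ} (hM : HasMatDeriv M M' t) :
    HasDerivAt (fun s => (M s).trace) M'.trace t := by
  simp only [Matrix.trace, Matrix.diag_apply]
  exact HasDerivAt.fun_sum fun k _ => hM k k

variable [Fintype a] [DecidableEq a]

/-- Jacobi's formula. -/
theorem det {M : ℝ → Matrix a a ℝ} {M' : Matrix a a ℝ} (hM : HasMatDeriv M M' t) :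
    HasDerivAt (fun s => (M s).det) ((M t).adjugate * M').trace t := by
  have h1 : HasDerivAt (fun s => (M s).det)
      (∑ σ : Equiv.Perm a, ((Equiv.Perm.sign σ : ℤ) : ℝ) *
        ∑ i, (∏ j ∈ Finset.univ.erase i, M t (σ j) j) * M' (σ i) i) t := by
    simp only [Matrix.det_apply']
    refine HasDerivAt.fun_sum fun σ _ => HasDerivAt.const_mul _ ?_
    simpa using HasDerivAt.fun_finsetProd (u := Finset.univ) fun i _ => hM (σ i) i
  convert h1 using 1
  -- Cramer's rule: each diagonal entry is the determinant with one column replaced by its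
  -- derivative, which is one summand of the Leibniz rule.
  have h2 : ∀ i, ((M t).adjugate * M') i i = ((M t).updateCol i (fun k => M' k i)).det := by
    intro i
    rw [← Matrix.cramer_apply, Matrix.cramer_eq_adjugate_mulVec]
    rfl
  simp only [Matrix.trace, Matrix.diag_apply, h2, Matrix.det_apply', Finset.mul_sum]
  rw [Finset.sum_comm]
  refine Finset.sum_congr rfl fun σ _ => Finset.sum_congr rfl fun i _ => ?_
  rw [← Finset.mul_prod_erase _ (fun j => (M t).updateCol i (fun k => M' k i) (σ j) j)
    (Finset.mem_univ i), Matrix.updateCol_self, mul_comm (M' (σ i) i)]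
  congr 2
  exact Finset.prod_congr rfl fun j hj => Matrix.updateCol_ne (Finset.ne_of_mem_erase hj)

/-- The adjugate formula gives differentiability of the inverse; its derivative is then found by
differentiating `M * M⁻¹ = 1`, valid near `t`. -/
theorem inv {M : ℝ → Matrix a a ℝ} {M' : Matrix a a ℝ} (hM : HasMatDeriv M M' t)
    (hu : IsUnit (M t).det) :
    HasMatDeriv (fun s => (M s)⁻¹) (-((M t)⁻¹ * M' * (M t)⁻¹)) t := by
  have hdiff : ∀ i j, DifferentiableAt ℝ (fun s => (M s)⁻¹ i j) t := by
    intro i j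
    have e : (fun s => (M s)⁻¹ i j) =
        fun s => (M s).det⁻¹ * ((M s).updateRow j (Pi.single i 1)).det := by
      funext s
      rw [Matrix.inv_def, Matrix.smul_apply, Matrix.adjugate_apply, Ring.inverse_eq_inv',
        smul_eq_mul]
    rw [e]
    refine (hM.det.differentiableAt.inv hu.ne_zero).mul ?_
    have h : HasMatDeriv (fun s => (M s).updateRow j (Pi.single i 1)) (M'.updateRow j 0) t := by
      intro p q
      by_cases hp : p = j
      · subst hp
        simpa using hasDerivAt_const t ((Pi.single i 1 : a → ℝ) q)
      · simpa [Matrix.updateRow_ne hp] using hM p q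
    exact h.det.differentiableAt
  let N : Matrix a a ℝ := Matrix.of fun i j => deriv (fun s => (M s)⁻¹ i j) t
  have hN : HasMatDeriv (fun s => (M s)⁻¹) N t := fun i j => (hdiff i j).hasDerivAt
  have hev : ∀ᶠ s in 𝓝 t, (1 : Matrix a a ℝ) = M s * (M s)⁻¹ := by
    filter_upwards [hM.det.continuousAt.eventually_ne hu.ne_zero] with s hs
    rw [Matrix.mul_nonsing_inv _ (isUnit_iff_ne_zero.2 hs)]
  have h0 : M' * (M t)⁻¹ + M t * N = 0 := ((hM.mul hN).congr hev).unique (const 1)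
  have h1 : N = -((M t)⁻¹ * M' * (M t)⁻¹) := by
    have h2 : M t * N = -(M' * (M t)⁻¹) := by
      rw [add_comm] at h0
      exact eq_neg_of_add_eq_zero_left h0
    rw [← Matrix.nonsing_inv_mul_cancel_left (M t) N hu, h2, Matrix.mul_neg, Matrix.mul_assoc]
  rwa [← h1]

end HasMatDeriv

/-! ### Gram matrices -/

variable {m n : ℕ}

/-- The Gram matrix `X diag(g) Xᵀ`. -/
def wGram (g : Fin n → ℝ) (X : Matrix (Fin m) (Fin n) ℝ) : Matrix (Fin m) (Fin m) ℝ :=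
  X * Matrix.diagonal g * X.transpose

theorem wGram_apply (g : Fin n → ℝ) (X : Matrix (Fin m) (Fin n) ℝ) (α β : Fin m) :
    wGram g X α β = ∑ k, X α k * g k * X β k := by
  rw [wGram, Matrix.mul_apply]
  simp only [Matrix.mul_diagonal, Matrix.transpose_apply]

theorem wGram_one (X : Matrix (Fin m) (Fin n) ℝ) : wGram 1 X = X * X.transpose := by
  simp [wGram]

theorem wGram_transpose (g : Fin n → ℝ) (X : Matrix (Fin m) (Fin n) ℝ) :
    (wGram g X).transpose = wGram g X := by
  simp [wGram, Matrix.transpose_mul, Matrix.mul_assoc]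

theorem wGram_mul (g : Fin n → ℝ) (A : Matrix (Fin m) (Fin m) ℝ) (X : Matrix (Fin m) (Fin n) ℝ) :
    wGram g (A * X) = A * wGram g X * A.transpose := by
  simp [wGram, Matrix.transpose_mul, Matrix.mul_assoc]

theorem wGram_posDef {g : Fin n → ℝ} (hg : ∀ k, 0 < g k) {X : Matrix (Fin m) (Fin n) ℝ}
    (hX : X.rank = m) : (wGram g X).PosDef := by
  have hd : (Matrix.diagonal g).PosDef := Matrix.PosDef.diagonal hg
  have := hd.mul_mul_conjTranspose_same (B := X) ?_
  · rwa [Matrix.conjTranspose_eq_transpose_of_trivial] at this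
  · rw [Matrix.vecMul_injective_iff]
    rw [linearIndependent_iff_card_eq_finrank_span, Set.finrank, ← Matrix.rank_eq_finrank_span_row,
      hX, Fintype.card_fin]

/-- The weights `λ_k⁻²`. -/
def wt (lam : Fin n → ℝ) (k : Fin n) : ℝ := (lam k ^ 2)⁻¹

theorem wt_pos {lam : Fin n → ℝ} (hpos : ∀ k, 0 < lam k) (k : Fin n) : 0 < wt lam k :=
  inv_pos.2 (pow_pos (hpos k) 2)

theorem wt_strictAnti {lam : Fin n → ℝ} (hpos : ∀ k, 0 < lam k) (hlam : StrictMono lam) :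
    StrictAnti (wt lam) := fun a b h => by
  have := hpos a
  have := hlam h
  unfold wt
  gcongr

theorem gramDet_eq (X : Matrix (Fin m) (Fin n) ℝ) : gramDet X = (wGram 1 X).det := by
  rw [gramDet, wGram_one]

theorem gramDet_rescale (lam : Fin n → ℝ) (X : Matrix (Fin m) (Fin n) ℝ) :
    gramDet (rescale lam X) = (wGram (wt lam) X).det := by
  rw [gramDet]
  congr 1
  ext α β
  rw [wGram_apply, Matrix.mul_apply]
  refine Finset.sum_congr rfl fun k _ => ?_
  simp only [rescale, wt, Matrix.of_apply, Matrix.transpose_apply]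
  -- Division by zero is zero, so both sides vanish in this case and no positivity is needed.
  by_cases h : lam k = 0
  · simp [h]
  · field_simp

/-- The function `f` on matrices. -/
def ratio (lam : Fin n → ℝ) (X : Matrix (Fin m) (Fin n) ℝ) : ℝ :=
  (wGram 1 X).det / (wGram (wt lam) X).det

theorem ratio_pos {lam : Fin n → ℝ} (hpos : ∀ k, 0 < lam k) {X : Matrix (Fin m) (Fin n) ℝ}
    (hX : X.rank = m) : 0 < ratio lam X :=
  div_pos (wGram_posDef (by simp) hX).det_pos (wGram_posDef (wt_pos hpos) hX).det_pos

theorem morseFun_proj (lam : Fin n → ℝ) (X : FullRank m n) :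
    morseFun lam (proj X) = ratio lam X.1 := by
  rw [ratio, ← gramDet_eq, ← gramDet_rescale]
  rfl

theorem ratio_mul (lam : Fin n → ℝ) {A : Matrix (Fin m) (Fin m) ℝ} (hA : IsUnit A.det)
    (X : Matrix (Fin m) (Fin n) ℝ) : ratio lam (A * X) = ratio lam X := by
  have := hA.ne_zero
  rw [ratio, ratio, wGram_mul, wGram_mul, Matrix.det_mul, Matrix.det_mul, Matrix.det_mul,
    Matrix.det_mul, Matrix.det_transpose, mul_right_comm, mul_right_comm _ (wGram _ X).det,
    mul_div_mul_left _ _ (mul_ne_zero this this)]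

theorem HasMatDeriv.wGram {X : ℝ → Matrix (Fin m) (Fin n) ℝ} {X' : Matrix (Fin m) (Fin n) ℝ}
    {t : ℝ} (hX : HasMatDeriv X X' t) (g : Fin n → ℝ) :
    HasMatDeriv (fun s => wGram g (X s))
      (X' * Matrix.diagonal g * (X t).transpose + X t * Matrix.diagonal g * X'.transpose) t :=
  (hX.mul_const _).mul hX.transpose

theorem trace_sym {N Q : Matrix (Fin m) (Fin m) ℝ} (hN : N.transpose = N) :
    (N * (Q + Q.transpose)).trace = 2 * (N * Q).trace := by
  have : (N * Q.transpose).trace = (N * Q).trace := by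
    rw [← Matrix.trace_transpose (N * Q), Matrix.transpose_mul, hN, Matrix.trace_mul_comm]
  rw [Matrix.mul_add, Matrix.trace_add, this, two_mul]

theorem inv_wGram_transpose (g : Fin n → ℝ) (X : Matrix (Fin m) (Fin n) ℝ) :
    ((wGram g X)⁻¹).transpose = (wGram g X)⁻¹ := by
  rw [Matrix.transpose_nonsing_inv, wGram_transpose]

theorem hasDerivAt_det_wGram {X : ℝ → Matrix (Fin m) (Fin n) ℝ} {X' : Matrix (Fin m) (Fin n) ℝ}
    {t : ℝ} (hX : HasMatDeriv X X' t) (g : Fin n → ℝ) (hu : IsUnit (wGram g (X t)).det) :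
    HasDerivAt (fun s => (wGram g (X s)).det)
      ((wGram g (X t)).det *
        (2 * ((wGram g (X t))⁻¹ * (X' * Matrix.diagonal g * (X t).transpose)).trace)) t := by
  convert (hX.wGram g).det using 1
  have e : X t * Matrix.diagonal g * X'.transpose
      = (X' * Matrix.diagonal g * (X t).transpose).transpose := by
    simp [Matrix.transpose_mul, Matrix.mul_assoc]
  rw [e, ← trace_sym (inv_wGram_transpose g (X t)), Matrix.inv_def, Matrix.smul_mul,
    Matrix.trace_smul, Ring.inverse_eq_inv', smul_eq_mul, mul_inv_cancel_left₀ hu.ne_zero]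

theorem hasDerivAt_ratio {lam : Fin n → ℝ} (hpos : ∀ k, 0 < lam k)
    {X : ℝ → Matrix (Fin m) (Fin n) ℝ} {X' : Matrix (Fin m) (Fin n) ℝ} {t : ℝ}
    (hX : HasMatDeriv X X' t) (hr : (X t).rank = m) :
    HasDerivAt (fun s => ratio lam (X s))
      (ratio lam (X t) * (2 * ((wGram 1 (X t))⁻¹ * (X' * (X t).transpose)).trace -
        2 * ((wGram (wt lam) (X t))⁻¹ *
          (X' * Matrix.diagonal (wt lam) * (X t).transpose)).trace)) t := by
  have h1 := (wGram_posDef (g := 1) (by simp) hr).det_pos.ne'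
  have h2 := (wGram_posDef (wt_pos hpos) hr).det_pos.ne'
  refine HasDerivAt.congr_deriv ((hasDerivAt_det_wGram hX 1 (isUnit_iff_ne_zero.2 h1)).fun_div
    (hasDerivAt_det_wGram hX (wt lam) (isUnit_iff_ne_zero.2 h2)) h2) ?_
  have e : (Matrix.diagonal 1 : Matrix (Fin n) (Fin n) ℝ) = 1 := Matrix.diagonal_one
  rw [ratio, e, Matrix.mul_one]
  field_simp

/-- The trace `tr (P diag(g))`, with `P` the orthogonal projection to the row space of `X`. -/
def wTrace (g : Fin n → ℝ) (X : Matrix (Fin m) (Fin n) ℝ) : ℝ :=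
  ((wGram 1 X)⁻¹ * wGram g X).trace

/-- The orthogonal projection to the row space of `X`. -/
def rowProj (X : Matrix (Fin m) (Fin n) ℝ) : Matrix (Fin n) (Fin n) ℝ :=
  X.transpose * (wGram 1 X)⁻¹ * X

/-- The derivatives of the two factors combine into a single pairing of `X'` with `X * diagonal g`
through `1 - rowProj`. By `metric_eq` this is the shape of the Riemannian metric, so the negative
gradient equation can be applied to it. -/
theorem hasDerivAt_wTrace {X : ℝ → Matrix (Fin m) (Fin n) ℝ} {X' : Matrix (Fin m) (Fin n) ℝ}
    {t : ℝ} (hX : HasMatDeriv X X' t) (hr : (X t).rank = m) (g : Fin n → ℝ) :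
    HasDerivAt (fun s => wTrace g (X s))
      (2 * ((wGram 1 (X t))⁻¹ * X' * (1 - rowProj (X t)) *
        (X t * Matrix.diagonal g).transpose).trace) t := by
  have h1 := isUnit_iff_ne_zero.2 (wGram_posDef (g := 1) (by simp) hr).det_pos.ne'
  refine HasDerivAt.congr_deriv (((hX.wGram 1).inv h1).mul (hX.wGram g)).trace ?_
  set N := (wGram 1 (X t))⁻¹ with hN
  have hNT : N.transpose = N := inv_wGram_transpose 1 (X t)
  have e : (Matrix.diagonal 1 : Matrix (Fin n) (Fin n) ℝ) = 1 := Matrix.diagonal_one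
  have e1 : X t * Matrix.diagonal g * X'.transpose
      = (X' * Matrix.diagonal g * (X t).transpose).transpose := by
    simp [Matrix.transpose_mul, Matrix.mul_assoc]
  have e2 : X' * (X t).transpose + X t * X'.transpose
      = X' * (X t).transpose + (X' * (X t).transpose).transpose := by
    simp [Matrix.transpose_mul]
  have hM : (N * wGram g (X t) * N).transpose = N * wGram g (X t) * N := by
    simp [Matrix.transpose_mul, hNT, wGram_transpose, Matrix.mul_assoc]
  rw [Matrix.trace_add, e, Matrix.mul_one, Matrix.mul_one, e1, trace_sym hNT, e2, Matrix.neg_mul,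
    Matrix.trace_neg, Matrix.mul_assoc (N * _), Matrix.mul_assoc N, Matrix.trace_mul_comm N,
    Matrix.mul_assoc _ _ N, Matrix.trace_mul_comm _ (N * _ * N) , trace_sym hM,
    rowProj, Matrix.transpose_mul, Matrix.diagonal_transpose,
    wGram]
  simp only [Matrix.mul_sub, Matrix.sub_mul, Matrix.mul_one, Matrix.trace_sub, Matrix.mul_assoc]
  have hc := Matrix.trace_mul_comm (N * (X t * Matrix.diagonal g * (X t).transpose))
    (N * (X' * (X t).transpose))
  simp only [Matrix.mul_assoc] at hc
  rw [← hN, hc]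
  ring

/-! ### Charts as block decompositions -/

/-- The coordinate matrix selecting the columns of `i`. -/
def selIn (i : Fin m ↪o Fin n) : Matrix (Fin m) (Fin n) ℝ :=
  (1 : Matrix (Fin n) (Fin n) ℝ).submatrix i id

/-- The coordinate matrix selecting the columns outside of `i`. -/
def selOut (i : Fin m ↪o Fin n) : Matrix (Compl i) (Fin n) ℝ :=
  (1 : Matrix (Fin n) (Fin n) ℝ).submatrix Subtype.val id

theorem chartMatrix_eq (i : Fin m ↪o Fin n) (Z : Coord i) :
    chartMatrix i Z = selIn i + Matrix.of Z * selOut i := by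
  ext α k
  by_cases h : k ∈ Set.range i
  · have : ∀ c : Compl i, ¬ (c : Fin n) = k := by
      rintro c rfl
      exact c.2 h
    simp only [chartMatrix, Matrix.of_apply, h, dite_true, Matrix.add_apply, selIn, selOut,
      Matrix.submatrix_apply, Matrix.mul_apply, Matrix.one_apply, id, this]
    simp
  · have h1 : ¬ i α = k := fun e => h ⟨α, e⟩
    have h2 : ∀ c : Compl i, (c : Fin n) = k ↔ c = ⟨k, h⟩ := fun c => by
      rw [Subtype.ext_iff]
    simp only [chartMatrix, Matrix.of_apply, h, dite_false, Matrix.add_apply, selIn, selOut,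
      Matrix.submatrix_apply, Matrix.mul_apply, Matrix.one_apply, id, h1, h2]
    simp

theorem mul_selIn_transpose {a : Type*} (i : Fin m ↪o Fin n) (X : Matrix a (Fin n) ℝ) :
    X * (selIn i).transpose = X.submatrix id i := by
  ext α k
  simp [selIn, Matrix.mul_apply, Matrix.one_apply]

theorem mul_selOut_transpose {a : Type*} (i : Fin m ↪o Fin n) (X : Matrix a (Fin n) ℝ) :
    X * (selOut i).transpose = X.submatrix id Subtype.val := by
  ext α k
  simp [selOut, Matrix.mul_apply, Matrix.one_apply]

theorem selOut_selOut (i : Fin m ↪o Fin n) : selOut i * (selOut i).transpose = 1 := by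
  rw [mul_selOut_transpose]
  ext α k
  simp [selOut, Matrix.one_apply, Subtype.ext_iff]

theorem selOut_selIn (i : Fin m ↪o Fin n) : selOut i * (selIn i).transpose = 0 := by
  rw [mul_selIn_transpose]
  ext α k
  have : (α : Fin n) ≠ i k := fun e => α.2 ⟨k, e.symm⟩
  simp [selOut, this]

theorem selIn_selOut (i : Fin m ↪o Fin n) : selIn i * (selOut i).transpose = 0 := by
  have := congrArg Matrix.transpose (selOut_selIn i)
  simpa [Matrix.transpose_mul] using this

theorem selIn_add_selOut (i : Fin m ↪o Fin n) :
    (selIn i).transpose * selIn i + (selOut i).transpose * selOut i = 1 := by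
  ext p q
  simp only [Matrix.add_apply, Matrix.mul_apply, Matrix.transpose_apply, selIn, selOut,
    Matrix.submatrix_apply, Matrix.one_apply, id]
  by_cases hp : p ∈ Set.range i
  · obtain ⟨α, rfl⟩ := hp
    have : ∀ c : Compl i, ¬ (c : Fin n) = i α := by
      rintro c e
      exact c.2 ⟨α, e.symm⟩
    simp only [this, if_false, zero_mul, Finset.sum_const_zero, add_zero]
    rw [Finset.sum_eq_single α (fun b _ hb => by simp [hb]) (by simp)]
    simp
  · have h1 : ∀ α, ¬ i α = p := fun α e => hp ⟨α, e⟩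
    have h2 : ∀ c : Compl i, (c : Fin n) = p ↔ c = ⟨p, hp⟩ := fun c => by
      rw [Subtype.ext_iff]
    simp only [h1, h2, if_false, zero_mul, Finset.sum_const_zero, zero_add]
    rw [Finset.sum_eq_single ⟨p, hp⟩ (fun b _ hb => by simp [hb]) (by simp)]
    simp

theorem selIn_chartMatrix (i : Fin m ↪o Fin n) (Z : Coord i) :
    chartMatrix i Z * (selIn i).transpose = 1 := by
  rw [mul_selIn_transpose, chartMatrix_submatrix]

theorem chartMatrix_selOut (i : Fin m ↪o Fin n) (Z : Coord i) :
    chartMatrix i Z * (selOut i).transpose = Matrix.of Z := by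
  rw [chartMatrix_eq, Matrix.add_mul, selIn_selOut, Matrix.mul_assoc, selOut_selOut, Matrix.mul_one,
    zero_add]

theorem wGram_chartMatrix (i : Fin m ↪o Fin n) (Z : Coord i) :
    wGram 1 (chartMatrix i Z) = 1 + Matrix.of Z * (Matrix.of Z).transpose := by
  rw [wGram_one]
  nth_rw 2 [chartMatrix_eq]
  rw [Matrix.transpose_add, Matrix.transpose_mul, Matrix.mul_add, selIn_chartMatrix,
    ← Matrix.mul_assoc, chartMatrix_selOut]

theorem wGram_one_posDef {X : Matrix (Fin m) (Fin n) ℝ} (hX : X.rank = m) :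
    (wGram 1 X).PosDef := wGram_posDef (by simp) hX

theorem isUnit_det_wGram_one {X : Matrix (Fin m) (Fin n) ℝ} (hX : X.rank = m) :
    IsUnit (wGram 1 X).det := isUnit_iff_ne_zero.2 (wGram_one_posDef hX).det_pos.ne'

theorem isUnit_det_wGram_wt {lam : Fin n → ℝ} (hpos : ∀ k, 0 < lam k)
    {X : Matrix (Fin m) (Fin n) ℝ} (hX : X.rank = m) :
    IsUnit (wGram (wt lam) X).det :=
  isUnit_iff_ne_zero.2 (wGram_posDef (wt_pos hpos) hX).det_pos.ne'

theorem mul_rowProj {X : Matrix (Fin m) (Fin n) ℝ} (hX : X.rank = m) : X * rowProj X = X := by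
  rw [rowProj, ← Matrix.mul_assoc, ← Matrix.mul_assoc, ← wGram_one,
    Matrix.mul_nonsing_inv _ (isUnit_det_wGram_one hX), Matrix.one_mul]

theorem rowProj_transpose (X : Matrix (Fin m) (Fin n) ℝ) : (rowProj X).transpose = rowProj X := by
  simp [rowProj, Matrix.transpose_mul, inv_wGram_transpose, Matrix.mul_assoc]

theorem rowProj_mul_transpose {X : Matrix (Fin m) (Fin n) ℝ} (hX : X.rank = m) :
    rowProj X * X.transpose = X.transpose := by
  have := congrArg Matrix.transpose (mul_rowProj hX)
  rwa [Matrix.transpose_mul, rowProj_transpose] at this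

/-- The metric in terms of the row space. -/
theorem metric_eq (i : Fin m ↪o Fin n) (Z W V : Coord i) :
    metric i Z W V = ((wGram 1 (chartMatrix i Z))⁻¹ * (Matrix.of W * selOut i) *
      (1 - rowProj (chartMatrix i Z)) * (Matrix.of V * selOut i).transpose).trace := by
  have hS := wGram_chartMatrix i Z
  have hu := isUnit_det_wGram_one (chartMatrix_rank i Z)
  set S := wGram 1 (chartMatrix i Z) with hSdef
  -- Woodbury's identity; the right side is the block of `1 - rowProj` on the columns outside `i`.
  have hinv : (1 + (Matrix.of Z).transpose * Matrix.of Z)⁻¹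
      = 1 - (Matrix.of Z).transpose * S⁻¹ * Matrix.of Z := by
    apply Matrix.inv_eq_right_inv
    have h1 : Matrix.of Z * (Matrix.of Z).transpose = S - 1 := by rw [hS]; abel
    have h2 : (Matrix.of Z).transpose * Matrix.of Z * ((Matrix.of Z).transpose * S⁻¹ * Matrix.of Z)
        = (Matrix.of Z).transpose * Matrix.of Z
          - (Matrix.of Z).transpose * S⁻¹ * Matrix.of Z := by
      calc _ = (Matrix.of Z).transpose * ((Matrix.of Z * (Matrix.of Z).transpose) * S⁻¹)
            * Matrix.of Z := by simp only [Matrix.mul_assoc]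
        _ = _ := by
          rw [h1, Matrix.sub_mul, Matrix.mul_nonsing_inv _ hu, Matrix.mul_sub, Matrix.sub_mul,
            Matrix.mul_one, Matrix.one_mul]
    rw [Matrix.add_mul, Matrix.one_mul, Matrix.mul_sub, Matrix.mul_one, h2]
    abel
  rw [metric, ← hS, hinv, Matrix.transpose_mul]
  congr 1
  have h3 : selOut i * (1 - rowProj (chartMatrix i Z)) * (selOut i).transpose
      = 1 - (Matrix.of Z).transpose * S⁻¹ * Matrix.of Z := by
    have h4 := congrArg Matrix.transpose (chartMatrix_selOut i Z)
    rw [Matrix.transpose_mul, Matrix.transpose_transpose] at h4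
    rw [Matrix.mul_sub, Matrix.sub_mul, Matrix.mul_one, selOut_selOut, rowProj]
    congr 1
    rw [← Matrix.mul_assoc, ← Matrix.mul_assoc, h4, Matrix.mul_assoc, chartMatrix_selOut]
  rw [← h3]
  simp only [Matrix.mul_assoc]

/-! ### Differentiability of the local expression of the function -/

theorem localFun_eq (lam : Fin n → ℝ) (i : Fin m ↪o Fin n) (Z : Coord i) :
    localFun lam i Z = ratio lam (chartMatrix i Z) := morseFun_proj lam _

theorem contDiff_chartMatrix (i : Fin m ↪o Fin n) (α : Fin m) (k : Fin n) (r : WithTop ℕ∞) :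
    ContDiff ℝ r (fun Z : Coord i => chartMatrix i Z α k) := by
  by_cases h : k ∈ Set.range i
  · simp only [chartMatrix, Matrix.of_apply, h, dite_true]
    exact contDiff_const
  · simp only [chartMatrix, Matrix.of_apply, h, dite_false]
    exact contDiff_apply_apply ℝ ℝ α _

theorem contDiff_det_wGram (i : Fin m ↪o Fin n) (g : Fin n → ℝ) (r : WithTop ℕ∞) :
    ContDiff ℝ r (fun Z : Coord i => (wGram g (chartMatrix i Z)).det) := by
  simp only [Matrix.det_apply', wGram_apply]
  refine ContDiff.sum fun σ _ => contDiff_const.mul (contDiff_prod fun α _ => ?_)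
  refine ContDiff.sum fun k _ => ?_
  exact ((contDiff_chartMatrix i _ k r).mul contDiff_const).mul (contDiff_chartMatrix i _ k r)

theorem contDiff_localFun {lam : Fin n → ℝ} (hpos : ∀ k, 0 < lam k) (i : Fin m ↪o Fin n)
    (r : WithTop ℕ∞) : ContDiff ℝ r (localFun lam i) := by
  have : localFun lam i = fun Z => (wGram 1 (chartMatrix i Z)).det /
      (wGram (wt lam) (chartMatrix i Z)).det := funext fun Z => localFun_eq lam i Z
  rw [this]
  exact (contDiff_det_wGram i 1 r).div (contDiff_det_wGram i _ r) fun Z =>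
    (isUnit_det_wGram_wt hpos (chartMatrix_rank i Z)).ne_zero

theorem hasMatDeriv_chartMatrix (i : Fin m ↪o Fin n) {Z : ℝ → Coord i} {W : Coord i} {t : ℝ}
    (hZ : HasDerivAt Z W t) :
    HasMatDeriv (fun s => chartMatrix i (Z s)) (Matrix.of W * selOut i) t := by
  have h : HasMatDeriv (fun s => Matrix.of (Z s)) (Matrix.of W) t := fun α k => by
    have h1 := hasDerivAt_pi.1 hZ α
    exact hasDerivAt_pi.1 h1 k
  simp only [chartMatrix_eq]
  simpa using (HasMatDeriv.const (selIn i)).add (h.mul_const (selOut i))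

theorem fderiv_localFun {lam : Fin n → ℝ} (hpos : ∀ k, 0 < lam k) (i : Fin m ↪o Fin n)
    (Z V : Coord i) : fderiv ℝ (localFun lam i) Z V =
      ratio lam (chartMatrix i Z) *
        (2 * ((wGram 1 (chartMatrix i Z))⁻¹ *
          (Matrix.of V * selOut i * (chartMatrix i Z).transpose)).trace -
        2 * ((wGram (wt lam) (chartMatrix i Z))⁻¹ *
          (Matrix.of V * selOut i * Matrix.diagonal (wt lam) *
            (chartMatrix i Z).transpose)).trace) := by
  have hZ : HasDerivAt (fun s : ℝ => Z + s • V) V 0 := by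
    simpa using ((hasDerivAt_id (0 : ℝ)).smul_const V).const_add Z
  have h1 := hasDerivAt_ratio hpos (hasMatDeriv_chartMatrix i hZ) (chartMatrix_rank i _)
  have h2 : HasFDerivAt (localFun lam i) (fderiv ℝ (localFun lam i) Z) (Z + (0 : ℝ) • V) := by
    simpa using ((contDiff_localFun hpos i 1).differentiable one_ne_zero Z).hasFDerivAt
  have h3 := h2.comp_hasDerivAt (0 : ℝ) hZ
  have h4 := h3.unique (h1.congr_of_eventuallyEq
    (Eventually.of_forall fun s => localFun_eq lam i _))
  simpa using h4

/-! ### The negative gradient -/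

/-- Multiplication by `1 - rowProj` removes the gauge term `H * X`, because `X * rowProj X = X`.
What is left pairs with a test vector exactly as the differential in `fderiv_localFun` does. -/
theorem IsNegGrad.of_matrix {lam : Fin n → ℝ} (hpos : ∀ k, 0 < lam k) {i : Fin m ↪o Fin n}
    {Z W : Coord i} (H : Matrix (Fin m) (Fin m) ℝ)
    (h : Matrix.of W * selOut i + H * chartMatrix i Z =
      (2 * ratio lam (chartMatrix i Z)) • (wGram 1 (chartMatrix i Z) *
        (wGram (wt lam) (chartMatrix i Z))⁻¹ * chartMatrix i Z * Matrix.diagonal (wt lam))) :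
    IsNegGrad lam i Z W := by
  intro V
  rw [metric_eq, fderiv_localFun hpos, eq_sub_of_add_eq h]
  have hr := chartMatrix_rank i Z
  have hu := isUnit_det_wGram_one hr
  have hb := isUnit_det_wGram_wt hpos hr
  have hbT := inv_wGram_transpose (wt lam) (chartMatrix i Z)
  have hsT := inv_wGram_transpose 1 (chartMatrix i Z)
  have hB : chartMatrix i Z * Matrix.diagonal (wt lam) * (chartMatrix i Z).transpose
    = wGram (wt lam) (chartMatrix i Z) := rfl
  have hX := mul_rowProj hr
  generalize hE : Matrix.of V * selOut i = E
  set X := chartMatrix i Z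
  set S := wGram 1 X with hS
  set B := wGram (wt lam) X with hBdef
  set D := Matrix.diagonal (wt lam)
  set c := ratio lam X
  have e1 : S⁻¹ * ((2 * c) • (S * B⁻¹ * X * D) - H * X) * (1 - rowProj X)
      = (2 * c) • (B⁻¹ * X * D - S⁻¹ * X) := by
    have e2 : S⁻¹ * (H * X) * (1 - rowProj X) = 0 := by
      rw [Matrix.mul_sub, Matrix.mul_one, Matrix.mul_assoc, Matrix.mul_assoc, hX, sub_self]
    have e3 : S⁻¹ * (S * B⁻¹ * X * D) = B⁻¹ * X * D := by
      simp only [Matrix.mul_assoc]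
      rw [Matrix.nonsing_inv_mul_cancel_left _ _ hu]
    have e4 : B⁻¹ * X * D * rowProj X = S⁻¹ * X := by
      calc _ = B⁻¹ * (X * D * X.transpose) * (S⁻¹ * X) := by
            simp only [rowProj, Matrix.mul_assoc, hS]
        _ = _ := by rw [hB, Matrix.nonsing_inv_mul _ hb, Matrix.one_mul]
    rw [Matrix.mul_sub S⁻¹, Matrix.sub_mul, e2, sub_zero, Matrix.mul_smul, e3, Matrix.smul_mul,
      Matrix.mul_sub, Matrix.mul_one, e4]
  rw [e1, Matrix.smul_mul, Matrix.trace_smul, Matrix.sub_mul, Matrix.trace_sub]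
  have t1 : (B⁻¹ * X * D * E.transpose).trace = (B⁻¹ * (E * D * X.transpose)).trace := by
    rw [← Matrix.trace_transpose, Matrix.trace_mul_comm B⁻¹]
    simp [Matrix.transpose_mul, hbT, Matrix.mul_assoc, D]
  have t2 : (S⁻¹ * X * E.transpose).trace = (S⁻¹ * (E * X.transpose)).trace := by
    rw [← Matrix.trace_transpose, Matrix.trace_mul_comm S⁻¹]
    simp [Matrix.transpose_mul, hsT, Matrix.mul_assoc]
  rw [t1, t2, smul_eq_mul]
  ring

/-- The derivative of `wTrace g` in the direction of the negative gradient. -/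
theorem IsNegGrad.trace_eq {lam : Fin n → ℝ} (hpos : ∀ k, 0 < lam k) {i : Fin m ↪o Fin n}
    {Z W : Coord i} (h : IsNegGrad lam i Z W) (g : Fin n → ℝ) :
    2 * ((wGram 1 (chartMatrix i Z))⁻¹ * (Matrix.of W * selOut i) *
      (1 - rowProj (chartMatrix i Z)) * (chartMatrix i Z * Matrix.diagonal g).transpose).trace =
    4 * ratio lam (chartMatrix i Z) *
      (((wGram (wt lam) (chartMatrix i Z))⁻¹ *
        wGram (fun k => g k * wt lam k) (chartMatrix i Z)).trace - wTrace g (chartMatrix i Z)) := by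
  have hr := chartMatrix_rank i Z
  have hu := isUnit_det_wGram_one hr
  have hb := isUnit_det_wGram_wt hpos hr
  have hP := rowProj_mul_transpose hr
  have hsel := selIn_chartMatrix i Z
  have hadd := selIn_add_selOut i
  have hh := fun V => h V
  simp only [metric_eq, fderiv_localFun hpos] at hh
  have hB : chartMatrix i Z * Matrix.diagonal (wt lam) * (chartMatrix i Z).transpose
    = wGram (wt lam) (chartMatrix i Z) := rfl
  have hS := (wGram_one (chartMatrix i Z)).symm
  set X := chartMatrix i Z
  set S := wGram 1 X
  set B := wGram (wt lam) X
  set D := Matrix.diagonal (wt lam)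
  set G := Matrix.diagonal g with hG
  -- The gauge matrix that makes the columns `i` of `X * G - H * X` vanish, so that this matrix is a
  -- legitimate chart vector and can be used as test vector for the gradient.
  set H := X * G * (selIn i).transpose with hH
  have hE : (X * G - H * X) * (selOut i).transpose * selOut i = X * G - H * X := by
    have h0 : (X * G - H * X) * (selIn i).transpose = 0 := by
      rw [Matrix.sub_mul, Matrix.mul_assoc H, hsel, Matrix.mul_one, sub_self]
    rw [Matrix.mul_assoc, eq_sub_of_add_eq' hadd, Matrix.mul_sub, ← Matrix.mul_assoc _ _ (selIn i),
      h0, Matrix.mul_one, Matrix.zero_mul, sub_zero]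
  have hV := hh (Matrix.of.symm ((X * G - H * X) * (selOut i).transpose))
  rw [Equiv.apply_symm_apply, hE] at hV
  have e1 : (1 - rowProj X) * (X * G - H * X).transpose = (1 - rowProj X) * (X * G).transpose := by
    rw [Matrix.transpose_sub, Matrix.transpose_mul H, Matrix.mul_sub,
      ← Matrix.mul_assoc _ X.transpose,
      Matrix.sub_mul 1 _ X.transpose, hP, Matrix.one_mul, sub_self, Matrix.zero_mul, sub_zero]
  rw [Matrix.mul_assoc, ← e1, ← Matrix.mul_assoc, hV]
  have e2 : (S⁻¹ * ((X * G - H * X) * X.transpose)).trace = wTrace g X - H.trace := by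
    rw [Matrix.sub_mul, Matrix.mul_assoc H, hS, Matrix.mul_sub, Matrix.trace_sub,
      Matrix.trace_mul_comm _ (H * S), Matrix.mul_assoc H, Matrix.mul_nonsing_inv _ hu,
      Matrix.mul_one]
    rfl
  have e3 : (B⁻¹ * ((X * G - H * X) * D * X.transpose)).trace =
      (B⁻¹ * wGram (fun k => g k * wt lam k) X).trace - H.trace := by
    have e4 : X * G * D * X.transpose = wGram (fun k => g k * wt lam k) X := by
      rw [Matrix.mul_assoc X G D, hG, Matrix.diagonal_mul_diagonal]
      rfl
    rw [Matrix.sub_mul, Matrix.sub_mul, e4, Matrix.mul_assoc H, Matrix.mul_assoc H, hB,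
      Matrix.mul_sub, Matrix.trace_sub, Matrix.trace_mul_comm _ (H * B), Matrix.mul_assoc H,
      Matrix.mul_nonsing_inv _ hb, Matrix.mul_one]
  rw [e2, e3]
  ring

/-! ### Simultaneous diagonalisation and the resulting inequalities -/

theorem inv_diagonal_of_pos {a : Fin m → ℝ} (ha : ∀ α, 0 < a α) :
    (Matrix.diagonal a)⁻¹ = Matrix.diagonal fun α => (a α)⁻¹ := by
  apply Matrix.inv_eq_right_inv
  rw [Matrix.diagonal_mul_diagonal, ← Matrix.diagonal_one]
  congr 1
  funext α
  exact mul_inv_cancel₀ (ha α).ne'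

theorem exists_orthogonal_diagonal {M : Matrix (Fin m) (Fin m) ℝ} (hM : M.IsHermitian) :
    ∃ U : Matrix (Fin m) (Fin m) ℝ, U * U.transpose = 1 ∧
      U * M * U.transpose = Matrix.diagonal hM.eigenvalues := by
  have h := hM.conjStarAlgAut_star_eigenvectorUnitary
  refine ⟨star (hM.eigenvectorUnitary : Matrix (Fin m) (Fin m) ℝ), ?_, ?_⟩
  · have := Unitary.coe_star_mul_self hM.eigenvectorUnitary
    rw [Matrix.star_eq_conjTranspose] at *
    simpa [Matrix.conjTranspose_eq_transpose_of_trivial] using this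
  · rw [Unitary.conjStarAlgAut_apply] at h
    simpa [Matrix.star_eq_conjTranspose, Matrix.conjTranspose_eq_transpose_of_trivial] using h

/-- Rescaling an eigenbasis of `S` by the inverse square roots of the eigenvalues turns `S` into the
identity; an orthogonal change of basis then diagonalises the transformed `B` and preserves the
identity. -/
theorem exists_simultaneous_diagonal {S B : Matrix (Fin m) (Fin m) ℝ} (hS : S.PosDef)
    (hB : B.transpose = B) : ∃ (R : Matrix (Fin m) (Fin m) ℝ) (a : Fin m → ℝ), IsUnit R.det ∧
      R * S * R.transpose = 1 ∧ R * B * R.transpose = Matrix.diagonal a := by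
  obtain ⟨U, -, hUS⟩ := exists_orthogonal_diagonal hS.isHermitian
  set e := hS.isHermitian.eigenvalues
  have he : ∀ α, 0 < e α := hS.eigenvalues_pos
  set Q := Matrix.diagonal fun α => (Real.sqrt (e α))⁻¹
  have h1 : (Q * U) * S * (Q * U).transpose = 1 := by
    calc _ = Q * (U * S * U.transpose) * Q := by
          simp only [Matrix.transpose_mul, Matrix.mul_assoc, Q, Matrix.diagonal_transpose]
      _ = 1 := by
          rw [hUS, Matrix.diagonal_mul_diagonal, Matrix.diagonal_mul_diagonal,
            ← Matrix.diagonal_one]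
          congr 1
          funext α
          have h2 := Real.sqrt_pos.2 (he α)
          have h3 := Real.mul_self_sqrt (he α).le
          field_simp
          rw [pow_two, h3]
  have hsym : ((Q * U) * B * (Q * U).transpose).IsHermitian := by
    rw [Matrix.IsHermitian, Matrix.conjTranspose_eq_transpose_of_trivial]
    simp [Matrix.transpose_mul, hB, Matrix.mul_assoc]
  obtain ⟨V, hV1, hVB⟩ := exists_orthogonal_diagonal hsym
  have key : V * (Q * U) * S * (V * (Q * U)).transpose = 1 := by
    calc _ = V * ((Q * U) * S * (Q * U).transpose) * V.transpose := by
          simp only [Matrix.transpose_mul, Matrix.mul_assoc]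
      _ = 1 := by rw [h1, Matrix.mul_one, hV1]
  refine ⟨V * (Q * U), hsym.eigenvalues, ?_, key, ?_⟩
  · have := congrArg Matrix.det key
    rw [Matrix.mul_assoc, Matrix.det_mul, Matrix.det_one] at this
    exact IsUnit.of_mul_eq_one _ this
  · rw [← hVB]
    simp only [Matrix.transpose_mul, Matrix.mul_assoc]

theorem trace_inv_conj {R S M : Matrix (Fin m) (Fin m) ℝ} (hR : IsUnit R.det) :
    ((R * S * R.transpose)⁻¹ * (R * M * R.transpose)).trace = (S⁻¹ * M).trace := by
  have hRT : IsUnit R.transpose.det := by rwa [Matrix.det_transpose]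
  rw [Matrix.mul_inv_rev, Matrix.mul_inv_rev]
  simp only [Matrix.mul_assoc]
  rw [Matrix.nonsing_inv_mul_cancel_left _ _ hR, Matrix.trace_mul_comm]
  simp only [Matrix.mul_assoc]
  rw [Matrix.mul_nonsing_inv _ hRT, Matrix.mul_one]

theorem wTrace_mul (g : Fin n → ℝ) {R : Matrix (Fin m) (Fin m) ℝ} (hR : IsUnit R.det)
    (X : Matrix (Fin m) (Fin n) ℝ) : wTrace g (R * X) = wTrace g X := by
  rw [wTrace, wGram_mul, wGram_mul, trace_inv_conj hR, wTrace]

/-- The rate of change of `wTrace g` along the negative gradient flow. -/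
def flowRate (lam g : Fin n → ℝ) (X : Matrix (Fin m) (Fin n) ℝ) : ℝ :=
  4 * ratio lam X * (((wGram (wt lam) X)⁻¹ * wGram (fun k => g k * wt lam k) X).trace - wTrace g X)

theorem flowRate_mul (lam g : Fin n → ℝ) {R : Matrix (Fin m) (Fin m) ℝ} (hR : IsUnit R.det)
    (X : Matrix (Fin m) (Fin n) ℝ) : flowRate lam g (R * X) = flowRate lam g X := by
  rw [flowRate, wTrace_mul g hR, ratio_mul lam hR, wGram_mul, wGram_mul, trace_inv_conj hR,
    flowRate]

/-- In a suitable basis of its row space, `X` diagonalises both Gram matrices. -/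
theorem exists_frame {lam : Fin n → ℝ} (hpos : ∀ k, 0 < lam k) {X : Matrix (Fin m) (Fin n) ℝ}
    (hX : X.rank = m) : ∃ (y : Fin m → Fin n → ℝ) (a : Fin m → ℝ),
      (∀ α, ∑ k, y α k ^ 2 = 1) ∧ (∀ α, a α = ∑ k, y α k ^ 2 * wt lam k) ∧ (∀ α, 0 < a α) ∧
      (∀ g, wTrace g X = ∑ α, ∑ k, y α k ^ 2 * g k) ∧
      ratio lam X = ∏ α, (a α)⁻¹ ∧
      (∀ g, flowRate lam g X = 4 * ratio lam X *
        ∑ α, ((a α)⁻¹ * ∑ k, y α k ^ 2 * (g k * wt lam k) - ∑ k, y α k ^ 2 * g k)) := by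
  obtain ⟨R, a, hR, h1, h2⟩ := exists_simultaneous_diagonal (wGram_one_posDef hX)
    (wGram_transpose (wt lam) X)
  rw [← wGram_mul] at h1 h2
  have hdiag : ∀ g α, wGram g (R * X) α α = ∑ k, (R * X) α k ^ 2 * g k := fun g α => by
    rw [wGram_apply]
    exact Finset.sum_congr rfl fun k _ => by ring
  have hy : ∀ α, ∑ k, (R * X) α k ^ 2 = 1 := fun α => by
    have := hdiag 1 α
    rw [h1, Matrix.one_apply_eq] at this
    simpa using this.symm
  have ha : ∀ α, a α = ∑ k, (R * X) α k ^ 2 * wt lam k := fun α => by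
    rw [← hdiag, h2, Matrix.diagonal_apply_eq]
  have hpa : ∀ α, 0 < a α := fun α => by
    rw [ha]
    refine lt_of_le_of_ne (Finset.sum_nonneg fun k _ => mul_nonneg (sq_nonneg _) (wt_pos hpos k).le)
      fun h0 => ?_
    have h3 := (Finset.sum_eq_zero_iff_of_nonneg
      (fun k _ => mul_nonneg (sq_nonneg ((R * X) α k)) (wt_pos hpos k).le)).1 h0.symm
    have h4 := hy α
    rw [Finset.sum_eq_zero fun k hk => (mul_eq_zero.1 (h3 k hk)).resolve_right (wt_pos hpos k).ne']
      at h4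
    exact zero_ne_one h4
  have hT : ∀ g, wTrace g X = ∑ α, ∑ k, (R * X) α k ^ 2 * g k := fun g => by
    rw [← wTrace_mul g hR, wTrace, h1, inv_one, Matrix.one_mul, Matrix.trace]
    exact Finset.sum_congr rfl fun α _ => hdiag g α
  refine ⟨fun α k => (R * X) α k, a, hy, ha, hpa, hT, ?_, fun g => ?_⟩
  · rw [← ratio_mul lam hR, ratio, h1, h2, Matrix.det_one, Matrix.det_diagonal, one_div,
      Finset.prod_inv_distrib]
  · rw [← flowRate_mul lam g hR, flowRate, ratio_mul lam hR, wTrace_mul g hR, hT, h2,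
      inv_diagonal_of_pos hpa,
      Matrix.trace, ← Finset.sum_sub_distrib]
    congr 1
    refine Finset.sum_congr rfl fun α _ => ?_
    rw [Matrix.diag_apply, Matrix.diagonal_mul, hdiag]

/-! ### Monotonicity and growth of the traces along the flow. -/

/-- Chebyshev's sum inequality with weights. -/
theorem chebyshev_weighted {p g d : Fin n → ℝ} (hp : ∀ k, 0 ≤ p k) (h1 : ∑ k, p k = 1)
    (hg : Antitone g) (hd : Antitone d) :
    (∑ k, p k * g k) * (∑ k, p k * d k) ≤ ∑ k, p k * (g k * d k) := by
  have h0 : 0 ≤ ∑ k, ∑ l, p k * p l * ((g k - g l) * (d k - d l)) := by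
    refine Finset.sum_nonneg fun k _ => Finset.sum_nonneg fun l _ => ?_
    refine mul_nonneg (mul_nonneg (hp k) (hp l)) ?_
    rcases le_total k l with h | h
    · exact mul_nonneg (sub_nonneg.2 (hg h)) (sub_nonneg.2 (hd h))
    · exact mul_nonneg_of_nonpos_of_nonpos (sub_nonpos.2 (hg h)) (sub_nonpos.2 (hd h))
  have e : ∑ k, ∑ l, p k * p l * ((g k - g l) * (d k - d l)) =
      (∑ k, p k * (g k * d k)) * (∑ l, p l) - (∑ k, p k * g k) * (∑ l, p l * d l)
      - (∑ k, p k * d k) * (∑ l, p l * g l) + (∑ k, p k) * (∑ l, p l * (g l * d l)) := by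
    simp only [Finset.sum_mul_sum, ← Finset.sum_sub_distrib, ← Finset.sum_add_distrib]
    exact Finset.sum_congr rfl fun k _ => Finset.sum_congr rfl fun l _ => by ring
  rw [e, h1] at h0
  linarith

/-- In the frame of `exists_frame` the squares `y α k ^ 2` form a probability distribution on `k`
for each `α`, and `g` and `wt lam` are both decreasing, hence nonnegatively correlated. -/
theorem flowRate_nonneg {lam : Fin n → ℝ} (hpos : ∀ k, 0 < lam k) (hlam : StrictMono lam)
    {g : Fin n → ℝ} (hg : Antitone g) {X : Matrix (Fin m) (Fin n) ℝ} (hX : X.rank = m) :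
    0 ≤ flowRate lam g X := by
  obtain ⟨y, a, hy, ha, hpa, -, -, hF⟩ := exists_frame hpos hX
  rw [hF]
  refine mul_nonneg (mul_nonneg (by norm_num) (ratio_pos hpos hX).le)
    (Finset.sum_nonneg fun α _ => ?_)
  have h := chebyshev_weighted (fun k => sq_nonneg (y α k)) (hy α) hg
    (wt_strictAnti hpos hlam).antitone
  rw [← ha α] at h
  rw [sub_nonneg, ← div_eq_inv_mul, le_div_iff₀ (hpa α)]
  exact h

/-- A linear bound with `K` independent of `g` and `X`. It serves as a Grönwall estimate: a trace
with nonnegative weights cannot leave or reach zero in finite time. -/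
theorem exists_flowRate_bound {lam : Fin n → ℝ} (hpos : ∀ k, 0 < lam k) (m : ℕ) :
    ∃ K : ℝ, 0 ≤ K ∧ ∀ (g : Fin n → ℝ), (∀ k, 0 ≤ g k) → ∀ X : Matrix (Fin m) (Fin n) ℝ,
      X.rank = m → |flowRate lam g X| ≤ K * wTrace g X := by
  obtain ⟨δ, hδ, hδle⟩ : ∃ δ : ℝ, 0 < δ ∧ ∀ k, δ ≤ wt lam k := by
    rcases isEmpty_or_nonempty (Fin n) with h | h
    · exact ⟨1, one_pos, fun k => h.elim k⟩
    · obtain ⟨k, hk⟩ := Finite.exists_min (wt lam)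
      exact ⟨wt lam k, wt_pos hpos k, hk⟩
  set M := ∑ k, wt lam k
  have hM : ∀ k, wt lam k ≤ M := fun k =>
    Finset.single_le_sum (fun k _ => (wt_pos hpos k).le) (Finset.mem_univ k)
  have hM0 : 0 ≤ M := Finset.sum_nonneg fun k _ => (wt_pos hpos k).le
  -- Each `a α` is a mean of the weights, hence at least `δ`: this bounds the ratio by `δ⁻¹ ^ m` and
  -- each weighted mean divided by `a α` by `δ⁻¹ * M` times the mean of `g`; the `+ 1` pays for the
  -- subtracted mean.
  refine ⟨4 * (δ⁻¹) ^ m * (δ⁻¹ * M + 1), by positivity, fun g hg X hX => ?_⟩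
  obtain ⟨y, a, hy, ha, hpa, hT, hR, hF⟩ := exists_frame hpos hX
  have haδ : ∀ α, (a α)⁻¹ ≤ δ⁻¹ := fun α => by
    refine inv_anti₀ hδ ?_
    rw [ha, ← mul_one δ, ← hy α, Finset.mul_sum]
    exact Finset.sum_le_sum fun k _ => by nlinarith [hδle k, sq_nonneg (y α k)]
  have hRle : ratio lam X ≤ (δ⁻¹) ^ m := by
    rw [hR]
    calc _ ≤ ∏ _α : Fin m, δ⁻¹ :=
          Finset.prod_le_prod (fun α _ => (inv_pos.2 (hpa α)).le) fun α _ => haδ α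
      _ = _ := by simp
  have hR0 := (ratio_pos hpos hX).le
  rw [hF, hT, abs_mul, abs_of_nonneg (by positivity), mul_assoc (4 * _)]
  refine mul_le_mul (by linarith) ?_ (abs_nonneg _) (by positivity)
  rw [Finset.mul_sum]
  refine (Finset.abs_sum_le_sum_abs _ _).trans (Finset.sum_le_sum fun α _ => ?_)
  have hG : 0 ≤ ∑ k, y α k ^ 2 * g k := Finset.sum_nonneg fun k _ => mul_nonneg (sq_nonneg _) (hg k)
  have hGd0 : 0 ≤ ∑ k, y α k ^ 2 * (g k * wt lam k) := Finset.sum_nonneg fun k _ =>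
    mul_nonneg (sq_nonneg _) (mul_nonneg (hg k) (wt_pos hpos k).le)
  have hGd : ∑ k, y α k ^ 2 * (g k * wt lam k) ≤ M * ∑ k, y α k ^ 2 * g k := by
    rw [Finset.mul_sum]
    refine Finset.sum_le_sum fun k _ => ?_
    calc _ = (y α k ^ 2 * g k) * wt lam k := by ring
      _ ≤ (y α k ^ 2 * g k) * M :=
          mul_le_mul_of_nonneg_left (hM k) (mul_nonneg (sq_nonneg _) (hg k))
      _ = _ := by ring
  have h1 : (a α)⁻¹ * ∑ k, y α k ^ 2 * (g k * wt lam k) ≤ δ⁻¹ * (M * ∑ k, y α k ^ 2 * g k) :=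
    mul_le_mul (haδ α) hGd hGd0 (inv_pos.2 hδ).le
  have h2 : 0 ≤ (a α)⁻¹ * ∑ k, y α k ^ 2 * (g k * wt lam k) :=
    mul_nonneg (inv_pos.2 (hpa α)).le hGd0
  have h3 : 0 ≤ δ⁻¹ * (M * ∑ k, y α k ^ 2 * g k) := h2.trans h1
  rw [abs_le]
  constructor <;> linarith

theorem wTrace_sub (g h : Fin n → ℝ) (X : Matrix (Fin m) (Fin n) ℝ) :
    wTrace (g - h) X = wTrace g X - wTrace h X := by
  have e : wGram (g - h) X = wGram g X - wGram h X := by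
    simp only [wGram]
    rw [← Matrix.sub_mul, ← Matrix.mul_sub, Matrix.diagonal_sub]
    rfl
  rw [wTrace, wTrace, wTrace, ← Matrix.trace_sub, ← Matrix.mul_sub, e]

theorem wTrace_add (g h : Fin n → ℝ) (X : Matrix (Fin m) (Fin n) ℝ) :
    wTrace (g + h) X = wTrace g X + wTrace h X := by
  have := wTrace_sub (g + h) h X
  rw [add_sub_cancel_right] at this
  linarith

theorem wTrace_eq_sum (g : Fin n → ℝ) (X : Matrix (Fin m) (Fin n) ℝ) :
    wTrace g X = ∑ k, g k * rowProj X k k := by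
  have e : wTrace g X = (Matrix.diagonal g * rowProj X).trace := by
    have h := Matrix.trace_mul_comm ((wGram 1 X)⁻¹ * X) (Matrix.diagonal g * X.transpose)
    have hg : wGram g X = X * (Matrix.diagonal g * X.transpose) := Matrix.mul_assoc _ _ _
    rw [wTrace, rowProj, hg]
    simp only [Matrix.mul_assoc] at h ⊢
    exact h
  rw [e, Matrix.trace]
  exact Finset.sum_congr rfl fun k _ => by rw [Matrix.diag_apply, Matrix.diagonal_mul]

/-! ### Trace functions on the Grassmannian -/

theorem det_isUnit_of_GL (A : GL (Fin m) ℝ) : IsUnit (A : Matrix (Fin m) (Fin m) ℝ).det :=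
  (Matrix.isUnit_iff_isUnit_det _).1 A.isUnit

/-- The function `W ↦ tr (P_W diag(g))` on the Grassmannian. -/
def trFun (g : Fin n → ℝ) : Gr m n → ℝ :=
  Quotient.lift (fun X : FullRank m n => wTrace g X.1)
    (by
      rintro X Y ⟨A, h⟩
      rw [h, wTrace_mul g (det_isUnit_of_GL A)])

theorem trFun_proj (g : Fin n → ℝ) (X : FullRank m n) : trFun g (proj X) = wTrace g X.1 := rfl

theorem proj_surjective : Function.Surjective (proj : FullRank m n → Gr m n) :=
  Quotient.mk_surjective

theorem proj_eq_iff {X Y : FullRank m n} : proj X = proj Y ↔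
    ∃ A : GL (Fin m) ℝ, Y.1 = (A : Matrix (Fin m) (Fin m) ℝ) * X.1 :=
  Quotient.eq (r := grSetoid m n)

theorem continuous_proj : Continuous (proj : FullRank m n → Gr m n) := continuous_quotient_mk'

theorem continuous_trFun (g : Fin n → ℝ) : Continuous (trFun g : Gr m n → ℝ) := by
  refine Continuous.quotient_lift ?_ _
  have hS : ∀ h : Fin n → ℝ, Continuous fun X : FullRank m n => wGram h X.1 := fun h =>
    (continuous_subtype_val.matrix_mul continuous_const).matrix_mul
      continuous_subtype_val.matrix_transpose
  have hinv : Continuous fun X : FullRank m n => (wGram 1 X.1)⁻¹ := by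
    simp only [Matrix.inv_def, Ring.inverse_eq_inv']
    exact ((hS 1).matrix_det.inv₀ fun X => (isUnit_det_wGram_one X.2).ne_zero).smul
      (hS 1).matrix_adjugate
  exact (hinv.matrix_mul (hS g)).matrix_trace

/-! ### Charts -/

theorem continuous_chartInv (i : Fin m ↪o Fin n) : Continuous (chartInv i) := by
  refine continuous_proj.comp (Continuous.subtype_mk ?_ _)
  exact continuous_matrix fun α k => (contDiff_chartMatrix i α k 0).continuous

theorem chart_chartInv (i : Fin m ↪o Fin n) (Z : Coord i) : chart i (chartInv i Z) = Z := by
  have h : chart i (chartInv i Z) = Matrix.of.symm (((chartMatrix i Z).submatrix id i)⁻¹ *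
      (chartMatrix i Z).submatrix id (Subtype.val : Compl i → Fin n)) := rfl
  rw [h, chartMatrix_submatrix, inv_one, Matrix.one_mul, ← mul_selOut_transpose, chartMatrix_selOut]
  rfl

theorem chartMatrix_chart (i : Fin m ↪o Fin n) (X : FullRank m n)
    (h : IsUnit (X.1.submatrix id i).det) :
    chartMatrix i (chart i (proj X)) = (X.1.submatrix id i)⁻¹ * X.1 := by
  have e : Matrix.of (chart i (proj X)) = (X.1.submatrix id i)⁻¹ *
      X.1.submatrix id (Subtype.val : Compl i → Fin n) := rfl
  rw [chartMatrix_eq, e, ← mul_selOut_transpose, ← mul_selIn_transpose]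
  rw [← mul_selIn_transpose] at h
  have h1 : selIn i = (X.1 * (selIn i).transpose)⁻¹ * (X.1 * ((selIn i).transpose * selIn i)) := by
    rw [← Matrix.mul_assoc X.1, Matrix.nonsing_inv_mul_cancel_left _ _ h]
  nth_rw 1 [h1]
  rw [Matrix.mul_assoc _ _ (selOut i), Matrix.mul_assoc X.1, ← Matrix.mul_add, ← Matrix.mul_add,
    selIn_add_selOut, Matrix.mul_one]

theorem proj_mem_chartDomain_iff (i : Fin m ↪o Fin n) (X : FullRank m n) :
    proj X ∈ chartDomain i ↔ IsUnit (X.1.submatrix id i).det := by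
  constructor
  · rintro ⟨Z, hZ⟩
    obtain ⟨A, hA⟩ := proj_eq_iff.1 hZ
    simp only at hA
    rw [hA, ← mul_selIn_transpose, Matrix.mul_assoc, selIn_chartMatrix, Matrix.mul_one]
    exact det_isUnit_of_GL A
  · intro h
    refine ⟨chart i (proj X), ?_⟩
    have hu : IsUnit (X.1.submatrix id i) := (Matrix.isUnit_iff_isUnit_det _).2 h
    refine proj_eq_iff.2 ⟨hu.unit, ?_⟩
    simp only
    rw [chartMatrix_chart i X h, IsUnit.unit_spec, Matrix.mul_nonsing_inv_cancel_left _ _ h]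

theorem chartInv_chart {i : Fin m ↪o Fin n} {p : Gr m n} (h : p ∈ chartDomain i) :
    chartInv i (chart i p) = p := by
  obtain ⟨Z, rfl⟩ := h
  rw [chart_chartInv]

theorem isOpen_chartDomain (i : Fin m ↪o Fin n) : IsOpen (chartDomain i) := by
  have hq : IsQuotientMap (proj : FullRank m n → Gr m n) := isQuotientMap_quotient_mk'
  rw [← hq.isOpen_preimage]
  have : proj ⁻¹' chartDomain i = {X : FullRank m n | (X.1.submatrix id i).det ≠ 0} := by
    ext X
    simp only [Set.mem_preimage, proj_mem_chartDomain_iff, isUnit_iff_ne_zero, Set.mem_ofPred_eq]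
  rw [this]
  exact isOpen_ne_fun (continuous_subtype_val.matrix_submatrix _ _).matrix_det continuous_const

/-- A basis of the column space chosen among the columns has `m` members; listed in increasing
order, their indices give the chart. -/
theorem exists_mem_chartDomain (p : Gr m n) : ∃ i : Fin m ↪o Fin n, p ∈ chartDomain i := by
  obtain ⟨X, rfl⟩ := proj_surjective p
  obtain ⟨κ, a, ha, hspan, hli⟩ := exists_linearIndependent' (K := ℝ) X.1.col
  have : Finite κ := Finite.of_injective a ha
  have : Fintype κ := Fintype.ofFinite κ
  have hcard : (Finset.univ.map ⟨a, ha⟩).card = m := by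
    rw [Finset.card_map, Finset.card_univ, linearIndependent_iff_card_eq_finrank_span.1 hli,
      Set.finrank, hspan, ← Matrix.rank_eq_finrank_span_cols, X.2]
  set i := (Finset.univ.map ⟨a, ha⟩).orderEmbOfFin hcard with hi
  have hmem : ∀ α, ∃ c, a c = i α := fun α => by
    obtain ⟨c, -, hc⟩ := Finset.mem_map.1
      ((Finset.univ.map ⟨a, ha⟩).orderEmbOfFin_mem hcard α)
    exact ⟨c, hc⟩
  choose e he using hmem
  refine ⟨i, (proj_mem_chartDomain_iff i X).2 ?_⟩
  rw [← Matrix.isUnit_iff_isUnit_det, ← Matrix.linearIndependent_cols_iff_isUnit]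
  have hinj : Function.Injective e := fun α β h => i.injective (by rw [← he, ← he, h])
  have hcol : (X.1.submatrix id i).col = (X.1.col ∘ a) ∘ e := by
    funext α β
    change X.1 β (i α) = X.1 β (a (e α))
    rw [he]
  rw [hcol]
  exact hli.comp e hinj

/-! ### Trace functions along flow lines -/

/-- The chart representative at time `t` serves for all weights `g` at once, which allows several
traces to be compared later. -/
theorem IsFlowLine.hasDerivAt_trFun {lam : Fin n → ℝ} (hpos : ∀ k, 0 < lam k) {γ : ℝ → Gr m n}
    (hγ : IsFlowLine lam γ) (t : ℝ) : ∃ X : FullRank m n, proj X = γ t ∧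
      ∀ g, HasDerivAt (fun s => trFun g (γ s)) (flowRate lam g X.1) t := by
  obtain ⟨i, hi⟩ := exists_mem_chartDomain (γ t)
  obtain ⟨W, hW, hd⟩ := hγ.2 t i hi
  refine ⟨⟨chartMatrix i (chart i (γ t)), chartMatrix_rank _ _⟩, chartInv_chart hi, fun g => ?_⟩
  have h1 := hasDerivAt_wTrace (hasMatDeriv_chartMatrix i hd) (chartMatrix_rank _ _) g
  have hev : ∀ᶠ s in 𝓝 t, γ s ∈ chartDomain i :=
    hγ.1.continuousAt.eventually ((isOpen_chartDomain i).mem_nhds hi)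
  refine HasDerivAt.congr_deriv (h1.congr_of_eventuallyEq ?_) (hW.trace_eq hpos g)
  filter_upwards [hev] with s hs
  rw [← trFun_proj g ⟨chartMatrix i (chart i (γ s)), chartMatrix_rank _ _⟩]
  exact congrArg _ (chartInv_chart hs).symm

theorem IsFlowLine.monotone_trFun {lam : Fin n → ℝ} (hpos : ∀ k, 0 < lam k)
    (hlam : StrictMono lam) {γ : ℝ → Gr m n} (hγ : IsFlowLine lam γ) {g : Fin n → ℝ}
    (hg : Antitone g) : Monotone fun t => trFun g (γ t) := by
  choose X hX hd using hγ.hasDerivAt_trFun hpos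
  refine monotone_of_deriv_nonneg (fun t => (hd t g).differentiableAt) fun t => ?_
  rw [(hd t g).deriv]
  exact flowRate_nonneg hpos hlam hg (X t).2

theorem chartMatrix_zero (i : Fin m ↪o Fin n) : chartMatrix i 0 = selIn i := by
  rw [chartMatrix_eq]
  have : (Matrix.of (0 : Coord i) : Matrix (Fin m) (Compl i) ℝ) = 0 := rfl
  rw [this, Matrix.zero_mul, add_zero]

theorem wGram_selIn (g : Fin n → ℝ) (i : Fin m ↪o Fin n) :
    wGram g (selIn i) = Matrix.diagonal (g ∘ i) := by
  ext α β
  rw [wGram_apply]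
  by_cases h : α = β
  · subst h
    simp [selIn, Matrix.one_apply]
  · simp [selIn, Matrix.one_apply, h]

theorem wGram_one_selIn (i : Fin m ↪o Fin n) : wGram 1 (selIn i) = 1 := by
  rw [wGram_selIn, ← Matrix.diagonal_one]
  rfl

theorem trFun_origin (g : Fin n → ℝ) (i : Fin m ↪o Fin n) :
    trFun g (origin i) = ∑ α, g (i α) := by
  have : trFun g (origin i) = wTrace g (chartMatrix i 0) := rfl
  rw [this, chartMatrix_zero, wTrace, wGram_one_selIn, inv_one, Matrix.one_mul, wGram_selIn,
    Matrix.trace_diagonal]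
  rfl

/-! ### Comparability of the endpoints of a flow line. -/

/-- The indicator of the first `c` indices. -/
def initInd (n c : ℕ) (k : Fin n) : ℝ := if (k : ℕ) < c then 1 else 0

theorem initInd_antitone (n c : ℕ) : Antitone (initInd n c) := by
  intro a b h
  have : (a : ℕ) ≤ b := h
  unfold initInd
  split_ifs <;> first | omega | norm_num

theorem sum_initInd (c : ℕ) (i : Fin m ↪o Fin n) :
    ∑ α, initInd n c (i α) = (Finset.univ.filter fun α => (i α : ℕ) < c).card := by
  simp [initInd]

/-- Critical points joined by a flow line are comparable in the Bruhat order. -/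
theorem IsFlowLine.le_of_tendsto {lam : Fin n → ℝ} (hpos : ∀ k, 0 < lam k)
    (hlam : StrictMono lam) {γ : ℝ → Gr m n} (hγ : IsFlowLine lam γ) {i l : Fin m ↪o Fin n}
    (hi : Tendsto γ atBot (𝓝 (origin i))) (hl : Tendsto γ atTop (𝓝 (origin l))) (α : Fin m) :
    l α ≤ i α := by
  by_contra! hlt
  set c := (i α : ℕ) + 1
  have hmono := hγ.monotone_trFun hpos hlam (initInd_antitone n c)
  have h1 := hmono.le_of_tendsto (((continuous_trFun _).tendsto _).comp hi) 0
  have h2 := hmono.ge_of_tendsto (((continuous_trFun _).tendsto _).comp hl) 0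
  have h3 := h1.trans h2
  rw [trFun_origin, trFun_origin, sum_initInd, sum_initInd, Nat.cast_le] at h3
  refine absurd h3 (not_le.2 (Finset.card_lt_card ?_))
  rw [Finset.ssubset_iff_of_subset]
  · refine ⟨α, by simp [c], ?_⟩
    have : (i α : ℕ) < l α := hlt
    simp only [Finset.mem_filter, Finset.mem_univ, true_and, not_lt, c]
    omega
  · intro β hβ
    simp only [Finset.mem_filter, Finset.mem_univ, true_and, c] at hβ ⊢
    have h4 : β < α := by
      by_contra! h5
      have h6 : (l α : ℕ) ≤ l β := l.monotone h5
      have h7 : (i α : ℕ) < l α := hlt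
      omega
    have h8 : (i β : ℕ) < i α := i.strictMono h4
    omega

theorem exists_eq_add_one_of_sum {i l : Fin m ↪o Fin n} (hle : ∀ α, l α ≤ i α)
    (hsum : ∑ α, (i α : ℕ) = ∑ α, (l α : ℕ) + 1) :
    ∃ k, (i k : ℕ) = l k + 1 ∧ ∀ j, j ≠ k → i j = l j := by
  have hle' : ∀ α, (l α : ℕ) ≤ i α := hle
  obtain ⟨k, hk⟩ : ∃ k, (l k : ℕ) < i k := by
    by_contra! h
    have := Finset.sum_le_sum fun α (_ : α ∈ Finset.univ) => h α
    omega
  rw [← Finset.add_sum_erase _ (fun α => (i α : ℕ)) (Finset.mem_univ k),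
    ← Finset.add_sum_erase _ (fun α => (l α : ℕ)) (Finset.mem_univ k)] at hsum
  have hs := Finset.sum_le_sum fun α (_ : α ∈ Finset.univ.erase k) => hle' α
  refine ⟨k, by omega, fun j hj => ?_⟩
  have he := (Finset.sum_eq_sum_iff_of_le fun α (_ : α ∈ Finset.univ.erase k) => hle' α).1
    (by omega) j (Finset.mem_erase.2 ⟨hj, Finset.mem_univ j⟩)
  exact Fin.ext he.symm

/-! ### The Morse index -/

/-- The coordinate subspace of the negative coefficients attains the supremum. Conversely, a
negative definite subspace meets the kernel of the projection to these coordinates trivially, since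
the form is nonnegative on that kernel. -/
theorem sSup_finrank_negative {κ : Type*} [Fintype κ] (c : Fin m → κ → ℝ) :
    sSup {r : ℕ | ∃ E : Submodule ℝ (Fin m → κ → ℝ), Module.finrank ℝ E = r ∧
      ∀ v ∈ E, v ≠ 0 → ∑ α, ∑ k, c α k * v α k ^ 2 < 0} =
    Nat.card {p : Fin m × κ // c p.1 p.2 < 0} := by
  classical
  have hcard : Module.finrank ℝ ({p : Fin m × κ // c p.1 p.2 < 0} → ℝ) =
      Nat.card {p : Fin m × κ // c p.1 p.2 < 0} := by
    rw [Module.finrank_fintype_fun_eq_card, Nat.card_eq_fintype_card]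
  refine IsGreatest.csSup_eq ⟨?_, ?_⟩
  · let ext : ({p : Fin m × κ // c p.1 p.2 < 0} → ℝ) →ₗ[ℝ] (Fin m → κ → ℝ) :=
      { toFun := fun w α k => if h : c α k < 0 then w ⟨(α, k), h⟩ else 0
        map_add' := fun w w' => by
          funext α k
          by_cases h : c α k < 0 <;> simp [h]
        map_smul' := fun r w => by
          funext α k
          by_cases h : c α k < 0 <;> simp [h] }
    have hinj : Function.Injective ext := fun w w' h => by
      funext p
      have := congrFun (congrFun h p.1.1) p.1.2
      simpa [ext, p.2] using this
    refine ⟨LinearMap.range ext, by rw [LinearMap.finrank_range_of_inj hinj, hcard], ?_⟩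
    rintro _ ⟨w, rfl⟩ hv
    have hnonpos : ∀ α k, c α k * ext w α k ^ 2 ≤ 0 := fun α k => by
      by_cases h : c α k < 0
      · exact mul_nonpos_of_nonpos_of_nonneg h.le (sq_nonneg _)
      · simp [ext, h]
    refine lt_of_le_of_ne (Finset.sum_nonpos fun α _ => Finset.sum_nonpos fun k _ => hnonpos α k)
      fun h0 => hv ?_
    have h1 := (Finset.sum_eq_zero_iff_of_nonpos
      fun α _ => Finset.sum_nonpos fun k _ => hnonpos α k).1 h0
    funext α k
    have h2 := (Finset.sum_eq_zero_iff_of_nonpos fun k _ => hnonpos α k).1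
      (h1 α (Finset.mem_univ α)) k (Finset.mem_univ k)
    by_cases h : c α k < 0
    · exact pow_eq_zero_iff two_ne_zero |>.1 ((mul_eq_zero.1 h2).resolve_left h.ne)
    · simp [ext, h]
  · rintro r ⟨E, rfl, hE⟩
    rw [← hcard]
    let res : (Fin m → κ → ℝ) →ₗ[ℝ] ({p : Fin m × κ // c p.1 p.2 < 0} → ℝ) :=
      { toFun := fun v p => v p.1.1 p.1.2
        map_add' := fun _ _ => rfl
        map_smul' := fun _ _ => rfl }
    refine LinearMap.finrank_le_finrank_of_injective (f := res.domRestrict E) ?_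
    rw [← LinearMap.ker_eq_bot, LinearMap.ker_eq_bot']
    rintro ⟨v, hv⟩ h0
    by_contra hne
    have hlt := hE v hv fun h => hne (Subtype.ext h)
    refine absurd hlt (not_lt.2 (Finset.sum_nonneg fun α _ => Finset.sum_nonneg fun k _ => ?_))
    by_cases h : c α k < 0
    · have : v α k = 0 := congrFun h0 ⟨(α, k), h⟩
      simp [this]
    · exact mul_nonneg (not_lt.1 h) (sq_nonneg _)

theorem selOut_diagonal_selOut (g : Fin n → ℝ) (i : Fin m ↪o Fin n) :
    selOut i * Matrix.diagonal g * (selOut i).transpose =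
      Matrix.diagonal fun k : Compl i => g k := by
  rw [mul_selOut_transpose]
  ext p q
  by_cases h : p = q
  · subst h
    simp [selOut, Matrix.one_apply]
  · have : (p : Fin n) ≠ q := fun e => h (Subtype.ext e)
    simp [selOut, h, this]

theorem selOut_diagonal_selIn (g : Fin n → ℝ) (i : Fin m ↪o Fin n) :
    selOut i * Matrix.diagonal g * (selIn i).transpose = 0 := by
  rw [mul_selIn_transpose]
  ext p q
  have : (p : Fin n) ≠ i q := fun e => p.2 ⟨q, e.symm⟩
  simp [selOut, this]

/-- At `0` the difference quotient of `t * K t` is `K t` itself, so continuity of `K` suffices and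
`K` need not be differentiated. -/
theorem fderiv_fderiv_of_eq_mul {E : Type*} [NormedAddCommGroup E] [NormedSpace ℝ E] {f : E → ℝ}
    (hf : ContDiff ℝ 2 f) {v : E} {K : ℝ → ℝ} (hK : ∀ t : ℝ, fderiv ℝ f (t • v) v = t * K t)
    (hcont : ContinuousAt K 0) : fderiv ℝ (fderiv ℝ f) 0 v v = K 0 := by
  have hd1 : HasDerivAt (fun t : ℝ => t * K t) (K 0) 0 := by
    rw [hasDerivAt_iff_tendsto_slope_zero]
    have : Tendsto K (𝓝[≠] 0) (𝓝 (K 0)) := hcont.tendsto.mono_left nhdsWithin_le_nhds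
    refine this.congr' ?_
    filter_upwards [self_mem_nhdsWithin] with t ht
    have ht' : t ≠ 0 := ht
    simp [ht']
  have hd2 : HasDerivAt (fun t : ℝ => fderiv ℝ f (t • v) v)
      (fderiv ℝ (fderiv ℝ f) 0 v v) 0 := by
    have hF : DifferentiableAt ℝ (fderiv ℝ f) 0 :=
      (hf.fderiv_right (m := 1) (by norm_num)).differentiable one_ne_zero 0
    have hF' : HasFDerivAt (fderiv ℝ f) (fderiv ℝ (fderiv ℝ f) 0) ((0 : ℝ) • v) := by
      rw [zero_smul]
      exact hF.hasFDerivAt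
    have hZ : HasDerivAt (fun s : ℝ => s • v) v 0 := by
      simpa using (hasDerivAt_id (0 : ℝ)).smul_const v
    exact (ContinuousLinearMap.apply ℝ ℝ v).hasFDerivAt.comp_hasDerivAt (0 : ℝ)
      (hF'.comp_hasDerivAt (0 : ℝ) hZ)
  simp only [hK] at hd2
  exact hd2.unique hd1

/-- The Hessian of the local expression of `f` at the origin of a chart. -/
theorem hessian_localFun {lam : Fin n → ℝ} (hpos : ∀ k, 0 < lam k) (i : Fin m ↪o Fin n)
    (v : Coord i) : fderiv ℝ (fderiv ℝ (localFun lam i)) 0 v v =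
      ∑ α, ∑ k : Compl i,
        (2 * ratio lam (selIn i) * (1 - wt lam k / wt lam (i α))) * v α k ^ 2 := by
  have hZ : ∀ t : ℝ, HasDerivAt (fun s : ℝ => s • v) v t := fun t => by
    simpa using (hasDerivAt_id t).smul_const v
  set V : Matrix (Fin m) (Compl i) ℝ := Matrix.of v with hV
  set X : ℝ → Matrix (Fin m) (Fin n) ℝ := fun s => chartMatrix i (s • v) with hX
  have hX0 : X 0 = selIn i := by simp only [hX, zero_smul, chartMatrix_zero]
  have hXd : ∀ t, HasMatDeriv X (V * selOut i) t := fun t => hasMatDeriv_chartMatrix i (hZ t)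
  have hr : ∀ t, (X t).rank = m := fun t => chartMatrix_rank i _
  have hXT : ∀ t, (X t).transpose =
      (selIn i).transpose + t • ((selOut i).transpose * V.transpose) :=
    fun t => by
      have : (Matrix.of (t • v) : Matrix (Fin m) (Compl i) ℝ) = t • V := rfl
      simp only [hX, chartMatrix_eq, this, Matrix.transpose_add, Matrix.smul_mul,
        Matrix.transpose_smul, Matrix.transpose_mul]
  set L := Matrix.diagonal fun k : Compl i => wt lam k with hL
  -- The blocks `selIn` and `selOut` are orthogonal for both weights, so the constant part of `X t`
  -- drops out and the radial derivative carries an explicit factor `t`; this is the cofactor.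
  let K : ℝ → ℝ := fun t => ratio lam (X t) *
    (2 * ((wGram 1 (X t))⁻¹ * (V * V.transpose)).trace -
      2 * ((wGram (wt lam) (X t))⁻¹ * (V * L * V.transpose)).trace)
  have hK : ∀ t, fderiv ℝ (localFun lam i) (t • v) v = t * K t := by
    intro t
    rw [fderiv_localFun hpos]
    change ratio lam (X t) * (2 * ((wGram 1 (X t))⁻¹ * (V * selOut i * (X t).transpose)).trace -
      2 * ((wGram (wt lam) (X t))⁻¹ *
        (V * selOut i * Matrix.diagonal (wt lam) * (X t).transpose)).trace) = _
    have e1 : V * selOut i * (X t).transpose = t • (V * V.transpose) := by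
      rw [hXT, Matrix.mul_add, Matrix.mul_assoc, selOut_selIn, Matrix.mul_zero, zero_add,
        Matrix.mul_smul, ← Matrix.mul_assoc (V * _), Matrix.mul_assoc V, selOut_selOut,
        Matrix.mul_one]
    have e2 : V * selOut i * Matrix.diagonal (wt lam) * (X t).transpose =
        t • (V * L * V.transpose) := by
      rw [hXT, Matrix.mul_add, Matrix.mul_assoc V, Matrix.mul_assoc V, selOut_diagonal_selIn,
        Matrix.mul_zero, zero_add, Matrix.mul_smul, ← Matrix.mul_assoc (V * _), Matrix.mul_assoc V,
        selOut_diagonal_selOut]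
    rw [e1, e2, Matrix.mul_smul, Matrix.mul_smul, Matrix.trace_smul, Matrix.trace_smul, smul_eq_mul,
      smul_eq_mul]
    simp only [K]
    ring
  have hcont : ContinuousAt K 0 := by
    have c1 := (hasDerivAt_ratio hpos (hXd 0) (hr 0)).continuousAt
    have c2 := ((((hXd 0).wGram 1).inv (isUnit_det_wGram_one (hr 0))).mul_const
      (V * V.transpose)).trace.continuousAt
    have c3 := ((((hXd 0).wGram (wt lam)).inv (isUnit_det_wGram_wt hpos (hr 0))).mul_const
      (V * L * V.transpose)).trace.continuousAt
    exact c1.mul ((continuousAt_const.mul c2).sub (continuousAt_const.mul c3))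
  rw [fderiv_fderiv_of_eq_mul (contDiff_localFun hpos i 2) hK hcont]
  simp only [K, hX0]
  rw [wGram_one_selIn, inv_one, Matrix.one_mul, wGram_selIn,
    inv_diagonal_of_pos (a := wt lam ∘ i) fun _ => wt_pos hpos _]
  simp only [Matrix.trace, Matrix.diag_apply, Matrix.diagonal_mul, Function.comp_apply]
  have e3 : ∀ α, (V * V.transpose) α α = ∑ k, v α k ^ 2 := fun α => by
    simp [Matrix.mul_apply, hV, pow_two]
  have e4 : ∀ α, (V * L * V.transpose) α α = ∑ k, v α k ^ 2 * wt lam k := fun α => by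
    rw [Matrix.mul_apply]
    refine Finset.sum_congr rfl fun k _ => ?_
    rw [hL, Matrix.mul_diagonal, Matrix.transpose_apply, hV, Matrix.of_apply]
    ring
  simp only [e3, e4]
  rw [← mul_sub, ← Finset.sum_sub_distrib, ← mul_assoc, mul_comm (ratio _ _) 2, Finset.mul_sum]
  refine Finset.sum_congr rfl fun α _ => ?_
  rw [Finset.mul_sum, ← Finset.sum_sub_distrib, Finset.mul_sum]
  refine Finset.sum_congr rfl fun k _ => ?_
  ring

/-- Counting from zero, there are `i α` indices below `i α`, and exactly `α` of them belong to `i`.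
-/
theorem card_compl_lt (i : Fin m ↪o Fin n) (α : Fin m) :
    Nat.card {k : Compl i // (k : Fin n) < i α} + α = i α := by
  classical
  have h1 : ((Finset.Iio (i α)).filter fun k => k ∉ Set.range i).card =
      Nat.card {k : Compl i // (k : Fin n) < i α} := by
    rw [Nat.card_eq_fintype_card, ← Fintype.card_coe]
    exact Fintype.card_congr
      { toFun := fun k => ⟨⟨k.1, (Finset.mem_filter.1 k.2).2⟩,
          Finset.mem_Iio.1 (Finset.mem_filter.1 k.2).1⟩
        invFun := fun k => ⟨k.1.1, Finset.mem_filter.2 ⟨Finset.mem_Iio.2 k.2, k.1.2⟩⟩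
        left_inv := fun _ => rfl
        right_inv := fun _ => rfl }
  have h2 : (Finset.Iio (i α)).filter (fun k => k ∈ Set.range i) =
      (Finset.Iio α).map i.toEmbedding := by
    ext k
    simp only [Finset.mem_filter, Finset.mem_Iio, Finset.mem_map, Set.mem_range]
    constructor
    · rintro ⟨h, β, rfl⟩
      exact ⟨β, i.lt_iff_lt.1 h, rfl⟩
    · rintro ⟨β, h, rfl⟩
      exact ⟨i.lt_iff_lt.2 h, β, rfl⟩
  have h3 := Finset.card_filter_add_card_filter_not (s := Finset.Iio (i α))
    (fun k => k ∈ Set.range i)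
  rw [h2, Finset.card_map, Fin.card_Iio, Fin.card_Iio, h1] at h3
  omega

/-- The Hessian coefficient of the coordinate `(α, k)` has the sign of `1 - wt k / wt (i α)`,
negative exactly when `k < i α`; the index counts these pairs. -/
theorem morseIndex_origin {lam : Fin n → ℝ} (hpos : ∀ k, 0 < lam k) (hlam : StrictMono lam)
    (i : Fin m ↪o Fin n) :
    morseIndex lam i (origin i) + ∑ α : Fin m, (α : ℕ) = ∑ α, (i α : ℕ) := by
  have hc : ∀ α (k : Compl i), 2 * ratio lam (selIn i) * (1 - wt lam k / wt lam (i α)) < 0 ↔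
      (k : Fin n) < i α := fun α k => by
    have h1 : 0 < ratio lam (selIn i) := by
      rw [← chartMatrix_zero]
      exact ratio_pos hpos (chartMatrix_rank i 0)
    rw [← not_le, mul_nonneg_iff_of_pos_left (by positivity), sub_nonneg,
      div_le_one (wt_pos hpos _), (wt_strictAnti hpos hlam).le_iff_ge, not_le]
  have h0 : chart i (origin i) = 0 := chart_chartInv i 0
  rw [morseIndex, h0]
  simp only [hessian_localFun hpos i]
  rw [sSup_finrank_negative fun α (k : Compl i) =>
    2 * ratio lam (selIn i) * (1 - wt lam k / wt lam (i α))]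
  have e : Nat.card {p : Fin m × Compl i //
      2 * ratio lam (selIn i) * (1 - wt lam p.2 / wt lam (i p.1)) < 0} =
      ∑ α, Nat.card {k : Compl i // (k : Fin n) < i α} := by
    rw [← Nat.card_sigma]
    refine Nat.card_congr
      { toFun := fun p => ⟨p.1.1, p.1.2, (hc _ _).1 p.2⟩
        invFun := fun p => ⟨(p.1, p.2.1), (hc _ _).2 p.2.2⟩
        left_inv := fun _ => rfl
        right_inv := fun _ => rfl }
  rw [e, ← Finset.sum_add_distrib]
  exact Finset.sum_congr rfl fun α _ => card_compl_lt i α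

/-! ### Flow lines from curves of matrices -/

theorem HasMatDeriv.submatrix {a b c d : Type*} {M : ℝ → Matrix a b ℝ} {M' : Matrix a b ℝ} {t : ℝ}
    (hM : HasMatDeriv M M' t) (f : c → a) (g : d → b) :
    HasMatDeriv (fun s => (M s).submatrix f g) (M'.submatrix f g) t :=
  fun p q => hM (f p) (g q)

/-- A curve of matrices satisfying the gradient equation up to a gauge term projects to a flow
line. -/
theorem isFlowLine_of_matrix {lam : Fin n → ℝ} (hpos : ∀ k, 0 < lam k) {X : ℝ → FullRank m n}
    {X' : ℝ → Matrix (Fin m) (Fin n) ℝ} (hX : ∀ t, HasMatDeriv (fun s => (X s).1) (X' t) t)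
    {H : ℝ → Matrix (Fin m) (Fin m) ℝ}
    (h : ∀ t, X' t + H t * (X t).1 = (2 * ratio lam (X t).1) • (wGram 1 (X t).1 *
        (wGram (wt lam) (X t).1)⁻¹ * (X t).1 * Matrix.diagonal (wt lam))) :
    IsFlowLine lam fun t => proj (X t) := by
  refine ⟨continuous_proj.comp (Continuous.subtype_mk ?_ _), fun t j hj => ?_⟩
  · exact continuous_matrix fun α c =>
      continuous_iff_continuousAt.2 fun t => (hX t α c).continuousAt
  rw [proj_mem_chartDomain_iff] at hj
  set A := ((X t).1.submatrix id j)⁻¹ with hA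
  have hAu : IsUnit A.det := Matrix.isUnit_nonsing_inv_det _ hj
  have hY : chartMatrix j (chart j (proj (X t))) = A * (X t).1 := chartMatrix_chart j (X t) hj
  have hd := (((hX t).submatrix id j).inv hj).mul
    ((hX t).submatrix id (Subtype.val : Compl j → Fin n))
  rw [← hA] at hd
  set N := -(A * (X' t).submatrix id j * A) * (X t).1.submatrix id (Subtype.val : Compl j → Fin n) +
    A * (X' t).submatrix id (Subtype.val : Compl j → Fin n) with hN
  refine ⟨Matrix.of.symm N, ?_, ?_⟩
  · have hW : N * selOut j + A * (X' t).submatrix id j * (A * (X t).1) = A * X' t := by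
      have e1 : N = (A * X' t - A * (X' t).submatrix id j * (A * (X t).1)) *
          (selOut j).transpose := by
        rw [hN, ← mul_selOut_transpose, ← mul_selOut_transpose, Matrix.sub_mul, Matrix.neg_mul,
          sub_eq_add_neg, add_comm]
        simp only [Matrix.mul_assoc]
      have e2 : (A * X' t - A * (X' t).submatrix id j * (A * (X t).1)) *
          (selIn j).transpose = 0 := by
        rw [Matrix.sub_mul, Matrix.mul_assoc _ (A * _), Matrix.mul_assoc A (X t).1,
          mul_selIn_transpose j (X t).1, hA, Matrix.nonsing_inv_mul _ hj, Matrix.mul_one,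
          Matrix.mul_assoc _ (X' t), mul_selIn_transpose, sub_self]
      rw [e1, Matrix.mul_assoc _ _ (selOut j), eq_sub_of_add_eq' (selIn_add_selOut j),
        Matrix.mul_sub, ← Matrix.mul_assoc _ _ (selIn j), e2, Matrix.mul_one, Matrix.zero_mul,
        sub_zero, sub_add_cancel]
    refine IsNegGrad.of_matrix hpos (A * (X' t).submatrix id j + A * H t * A⁻¹) ?_
    rw [Equiv.apply_symm_apply, hY, Matrix.add_mul (A * _), ← add_assoc, hW, Matrix.mul_assoc _ A⁻¹,
      Matrix.nonsing_inv_mul_cancel_left _ _ hAu, Matrix.mul_assoc A, ← Matrix.mul_add, h t,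
      ratio_mul lam hAu, Matrix.mul_smul, wGram_mul, wGram_mul, Matrix.mul_inv_rev,
      Matrix.mul_inv_rev]
    congr 1
    have hAT : IsUnit A.transpose.det := by rwa [Matrix.det_transpose]
    simp only [Matrix.mul_assoc]
    rw [Matrix.mul_nonsing_inv_cancel_left _ _ hAT, Matrix.nonsing_inv_mul_cancel_left _ _ hAu]
  · rw [hasDerivAt_pi]
    intro α
    rw [hasDerivAt_pi]
    intro c
    exact hd α c

/-! ### Scalar equations -/

/-- A bounded, positive, continuous vector field on the line has a global solution, which is
increasing and surjective. -/
theorem exists_solution {v : ℝ → ℝ} (hv : Continuous v) (h0 : ∀ x, 0 < v x) {K : ℝ}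
    (hK : ∀ x, v x ≤ K) : ∃ x : ℝ → ℝ, (∀ t, HasDerivAt x (v (x t)) t) ∧ Function.Surjective x ∧
      Tendsto x atTop atTop ∧ Tendsto x atBot atBot := by
  have hKpos : 0 < K := (h0 0).trans_le (hK 0)
  have hcont : Continuous fun x => (v x)⁻¹ := hv.inv₀ fun x => (h0 x).ne'
  -- The time needed to travel from `0` to `y`. The solution is its inverse, and `v ≤ K` makes `F`
  -- grow at least linearly, hence onto.
  set F : ℝ → ℝ := fun y => ∫ s in (0 : ℝ)..y, (v s)⁻¹ with hF
  have hFd : ∀ y, HasDerivAt F (v y)⁻¹ y := fun y =>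
    hcont.integral_hasStrictDerivAt 0 y |>.hasDerivAt
  have hmono : StrictMono F := strictMono_of_deriv_pos fun y => by
    rw [(hFd y).deriv]
    exact inv_pos.2 (h0 y)
  have hG : Monotone fun y => F y - K⁻¹ * y := by
    have hGd : ∀ y, HasDerivAt (fun y => F y - K⁻¹ * y) ((v y)⁻¹ - K⁻¹) y := fun y => by
      simpa using (hFd y).fun_sub ((hasDerivAt_id y).const_mul K⁻¹)
    refine monotone_of_deriv_nonneg (fun y => (hGd y).differentiableAt) fun y => ?_
    rw [(hGd y).deriv, sub_nonneg]
    exact inv_anti₀ (h0 y) (hK y)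
  have hF0 : F 0 = 0 := by simp [hF]
  have htop : Tendsto F atTop atTop := by
    refine tendsto_atTop_mono' _ ?_ (tendsto_id.const_mul_atTop (inv_pos.2 hKpos))
    filter_upwards [eventually_ge_atTop 0] with y hy
    have := hG hy
    simp only [hF0, mul_zero, sub_zero] at this
    simpa using this
  have hbot : Tendsto F atBot atBot := by
    refine tendsto_atBot_mono' _ ?_ (tendsto_id.const_mul_atBot (inv_pos.2 hKpos))
    filter_upwards [eventually_le_atBot 0] with y hy
    have := hG hy
    simp only [hF0, mul_zero, sub_zero] at this
    simpa using this
  have hFc : Continuous F := continuous_iff_continuousAt.2 fun y => (hFd y).continuousAt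
  set e := hmono.orderIsoOfSurjective F (hFc.surjective htop hbot) with he
  refine ⟨e.symm, fun t => ?_, e.symm.surjective, e.symm.tendsto_atTop, e.symm.tendsto_atBot⟩
  have := HasDerivAt.of_local_left_inverse (f := F) (g := e.symm) (a := t)
    e.symm.continuous.continuousAt (hFd (e.symm t)) (inv_pos.2 (h0 _)).ne'
    (Eventually.of_forall fun y => e.apply_symm_apply y)
  simpa using this

/-- The product `u * exp (-K s)` is nonincreasing, so a zero of `u` would force `u ≤ 0` ever after,
against the limit 1. -/
theorem pos_of_deriv_le {u u' : ℝ → ℝ} {K : ℝ} (h0 : ∀ t, 0 ≤ u t)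
    (hd : ∀ t, HasDerivAt u (u' t) t) (hle : ∀ t, u' t ≤ K * u t)
    (hlim : Tendsto u atTop (𝓝 1)) (t : ℝ) : 0 < u t := by
  refine lt_of_le_of_ne (h0 t) fun hz => ?_
  have hd2 : ∀ s, HasDerivAt (fun s => u s * Real.exp (-K * s))
      (u' s * Real.exp (-K * s) + u s * (Real.exp (-K * s) * (-K))) s := fun s => by
    have h1 : HasDerivAt (fun s : ℝ => -K * s) (-K) s := by
      simpa using (hasDerivAt_id s).const_mul (-K)
    exact (hd s).mul h1.exp
  have hanti : Antitone fun s => u s * Real.exp (-K * s) := by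
    refine antitone_of_deriv_nonpos (fun s => (hd2 s).differentiableAt) fun s => ?_
    rw [(hd2 s).deriv]
    nlinarith [hle s, Real.exp_pos (-K * s)]
  have hzero : ∀ s, t ≤ s → u s ≤ 0 := fun s hs => by
    have h1 := hanti hs
    simp only [← hz, zero_mul] at h1
    by_contra! h2
    exact absurd h1 (not_le.2 (mul_pos h2 (Real.exp_pos _)))
  have := le_of_tendsto hlim ((eventually_ge_atTop t).mono hzero)
  norm_num at this

/-! ### Points whose projection is almost diagonal -/

theorem rowProj_mul_rowProj {X : Matrix (Fin m) (Fin n) ℝ} (hX : X.rank = m) :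
    rowProj X * rowProj X = rowProj X := by
  nth_rw 1 [rowProj]
  rw [Matrix.mul_assoc, mul_rowProj hX, rowProj]

theorem rowProj_symm (X : Matrix (Fin m) (Fin n) ℝ) (a b : Fin n) :
    rowProj X a b = rowProj X b a :=
  congrFun (congrFun (rowProj_transpose X) b) a

theorem rowProj_diag {X : Matrix (Fin m) (Fin n) ℝ} (hX : X.rank = m) (c : Fin n) :
    rowProj X c c = ∑ b, rowProj X c b ^ 2 := by
  have h : rowProj X c c = (rowProj X * rowProj X) c c := by rw [rowProj_mul_rowProj hX]
  rw [h, Matrix.mul_apply]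
  refine Finset.sum_congr rfl fun b _ => ?_
  rw [rowProj_symm X b c, pow_two]

theorem rowProj_diag_nonneg {X : Matrix (Fin m) (Fin n) ℝ} (hX : X.rank = m) (c : Fin n) :
    0 ≤ rowProj X c c := by
  rw [rowProj_diag hX]
  exact Finset.sum_nonneg fun b _ => sq_nonneg _

/-- Idempotence and symmetry give `P c c = ∑ b, P c b ^ 2`; if the diagonal term already accounts
for the whole sum, the other squares vanish. -/
theorem rowProj_eq_zero {X : Matrix (Fin m) (Fin n) ℝ} (hX : X.rank = m) {c : Fin n}
    (h : rowProj X c c ^ 2 = rowProj X c c) {b : Fin n} (hb : b ≠ c) : rowProj X c b = 0 := by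
  have h1 := rowProj_diag hX c
  rw [← Finset.add_sum_erase _ _ (Finset.mem_univ c), h] at h1
  have h2 := (Finset.sum_eq_zero_iff_of_nonneg fun b _ => sq_nonneg (rowProj X c b)).1
    (left_eq_add.1 h1) b (Finset.mem_erase.2 ⟨hb, Finset.mem_univ b⟩)
  exact pow_eq_zero_iff two_ne_zero |>.1 h2

theorem wTrace_single (c : Fin n) (X : Matrix (Fin m) (Fin n) ℝ) :
    wTrace (Pi.single c 1) X = rowProj X c c := by
  rw [wTrace_eq_sum]
  simp [Pi.single_apply]

theorem rowProj_mul {R : Matrix (Fin m) (Fin m) ℝ} (hR : IsUnit R.det)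
    (X : Matrix (Fin m) (Fin n) ℝ) : rowProj (R * X) = rowProj X := by
  have hRT : IsUnit R.transpose.det := by rwa [Matrix.det_transpose]
  rw [rowProj, rowProj, wGram_mul, Matrix.mul_inv_rev, Matrix.mul_inv_rev, Matrix.transpose_mul]
  simp only [Matrix.mul_assoc]
  rw [Matrix.mul_nonsing_inv_cancel_left _ _ hRT, Matrix.nonsing_inv_mul_cancel_left _ _ hR]

/-- The point of the chart `i` all of whose coordinates vanish, except for the coordinate `(k, s)`,
which is `z`. -/
def axis (i : Fin m ↪o Fin n) (k : Fin m) (s : Fin n) (z : ℝ) : Coord i :=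
  fun α c => if α = k ∧ (c : Fin n) = s then z else 0

theorem chartMatrix_axis {i : Fin m ↪o Fin n} (k : Fin m) {s : Fin n} (hs : s ∉ Set.range i)
    (z : ℝ) : chartMatrix i (axis i k s z) = selIn i + Matrix.single k s z := by
  ext α c
  by_cases h : c ∈ Set.range i
  · have hcs : s ≠ c := fun e => hs (e ▸ h)
    simp only [chartMatrix, Matrix.of_apply, h, dite_true, Matrix.add_apply, selIn,
      Matrix.submatrix_apply, Matrix.one_apply, id, Matrix.single_apply, hcs, and_false, if_false,
      add_zero]
  · have h1 : ¬ i α = c := fun e => h ⟨α, e⟩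
    simp only [chartMatrix, Matrix.of_apply, h, dite_false, Matrix.add_apply, selIn, axis,
      Matrix.submatrix_apply, Matrix.one_apply, id, Matrix.single_apply, h1, if_false, zero_add]
    simp only [eq_comm]

/-- A point whose projection has diagonal entries as at `origin i`, except possibly at `i k` and at
`s`, lies on an axis of the chart `i` unless it contains the `s`-th basis vector. -/
theorem exists_eq_axis {i : Fin m ↪o Fin n} {k : Fin m} {s : Fin n} (hs : s ∉ Set.range i)
    (X : FullRank m n) (h1 : ∀ α, α ≠ k → rowProj X.1 (i α) (i α) = 1)
    (h0 : ∀ c, c ∉ Set.range i → c ≠ s → rowProj X.1 c c = 0)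
    (hk : rowProj X.1 (i k) (i k) ≠ 0) (hs1 : rowProj X.1 s s ≠ 1) :
    proj X = chartInv i (axis i k s (chart i (proj X) k ⟨s, hs⟩)) := by
  have hoff : ∀ α, α ≠ k → ∀ b, b ≠ i α → rowProj X.1 (i α) b = 0 := fun α hα b hb =>
    rowProj_eq_zero X.2 (by rw [h1 α hα]; norm_num) hb
  have hdom : IsUnit (X.1.submatrix id i).det := by
    -- This block has the minor `X_i` as a factor and is diagonal with nonzero entries, so `X_i` is
    -- invertible and the point lies in the chart.
    have e1 : (rowProj X.1).submatrix i i =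
        (X.1.submatrix id i).transpose * ((wGram 1 X.1)⁻¹ * X.1.submatrix id i) := by
      rw [rowProj, Matrix.mul_assoc]
      ext a b
      simp [Matrix.mul_apply]
    have e2 : (rowProj X.1).submatrix i i = Matrix.diagonal fun α => rowProj X.1 (i α) (i α) := by
      ext a b
      by_cases hab : a = b
      · subst hab
        simp
      · rw [Matrix.submatrix_apply, Matrix.diagonal_apply_ne _ hab]
        by_cases ha : a = k
        · have hb : b ≠ k := fun e => hab (ha.trans e.symm)
          rw [rowProj_symm]
          exact hoff b hb _ fun e => hab (i.injective e)
        · exact hoff a ha _ fun e => hab (i.injective e).symm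
    have e3 : ((rowProj X.1).submatrix i i).det ≠ 0 := by
      rw [e2, Matrix.det_diagonal, Finset.prod_ne_zero_iff]
      intro α _
      by_cases hα : α = k
      · rw [hα]
        exact hk
      · rw [h1 α hα]
        exact one_ne_zero
    rw [e1, Matrix.det_mul, Matrix.det_transpose] at e3
    exact isUnit_iff_ne_zero.2 (left_ne_zero_of_mul e3)
  have hmem := (proj_mem_chartDomain_iff i X).2 hdom
  have hY := chartMatrix_chart i X hdom
  set Z := chart i (proj X) with hZ
  have hP : rowProj (chartMatrix i Z) = rowProj X.1 := by
    rw [hY, rowProj_mul (Matrix.isUnit_nonsing_inv_det _ hdom)]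
  have hYP := mul_rowProj (chartMatrix_rank i Z)
  rw [hP] at hYP
  have hin : ∀ α β, chartMatrix i Z α (i β) = if α = β then 1 else 0 := fun α β => by
    have := congrFun (congrFun (chartMatrix_submatrix i Z) α) β
    rwa [Matrix.submatrix_apply, Matrix.one_apply] at this
  have hout : ∀ α (c : Compl i), chartMatrix i Z α c = Z α c := fun α c => by
    have hc := c.2
    simp only [chartMatrix, Matrix.of_apply, hc, dite_false]
  rw [← chartInv_chart hmem, ← hZ]
  congr 1
  funext α c
  have hrow := congrFun (congrFun hYP α) (c : Fin n)
  rw [Matrix.mul_apply, hout] at hrow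
  unfold axis
  by_cases hcs : (c : Fin n) = s
  · have hc : c = ⟨s, hs⟩ := Subtype.ext hcs
    by_cases hα : α = k
    · rw [if_pos ⟨hα, hcs⟩, hα, hc]
    · rw [if_neg fun h => hα h.1]
      -- In column `s` the relation `Y * P = Y` reduces to `Z α s * P s s = Z α s`, and `P s s ≠ 1`.
      rw [Finset.sum_eq_single s] at hrow
      · rw [← hcs, hout, hcs] at hrow
        have : Z α c * (rowProj X.1 s s - 1) = 0 := by linarith
        exact (mul_eq_zero.1 this).resolve_right (sub_ne_zero.2 hs1)
      · intro b _ hb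
        by_cases hbi : b ∈ Set.range i
        · obtain ⟨β, rfl⟩ := hbi
          rw [hin]
          by_cases hαβ : α = β
          · rw [← hαβ, hoff α hα c fun e => c.2 ⟨α, e.symm⟩, mul_zero]
          · rw [if_neg hαβ, zero_mul]
        · rw [rowProj_eq_zero X.2 (by rw [h0 b hbi hb]; norm_num) (hcs ▸ hb.symm), mul_zero]
      · simp
  · rw [if_neg fun h => hcs h.2, ← hrow]
    refine Finset.sum_eq_zero fun b _ => ?_
    have hz := h0 c c.2 hcs
    rw [rowProj_symm]
    by_cases hb : b = c
    · rw [hb, hz, mul_zero]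
    · rw [rowProj_eq_zero X.2 (by rw [hz]; norm_num) hb, mul_zero]

/-! ### The axis joining two neighbouring critical points -/

theorem axisMatrix_apply (i : Fin m ↪o Fin n) (k α : Fin m) (s c : Fin n) (z : ℝ) :
    (selIn i + Matrix.single k s z) α c =
      (if i α = c then 1 else 0) + (if k = α ∧ s = c then z else 0) := by
  rw [Matrix.add_apply, Matrix.single_apply, selIn, Matrix.submatrix_apply, Matrix.one_apply, id]

theorem wGram_axis (g : Fin n → ℝ) {i : Fin m ↪o Fin n} (k : Fin m) {s : Fin n}
    (hs : s ∉ Set.range i) (z : ℝ) : wGram g (selIn i + Matrix.single k s z) =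
      Matrix.diagonal fun α => g (i α) + if k = α then z ^ 2 * g s else 0 := by
  have hsi : ∀ α, s ≠ i α := fun α e => hs ⟨α, e.symm⟩
  ext α β
  rw [wGram_apply]
  simp only [axisMatrix_apply, Matrix.diagonal_apply]
  have e : ∀ c, ((if i α = c then (1 : ℝ) else 0) + (if k = α ∧ s = c then z else 0)) * g c *
      ((if i β = c then 1 else 0) + (if k = β ∧ s = c then z else 0)) =
      (if i α = c then (if α = β then g (i α) else 0) else 0) +
      (if s = c then (if k = α ∧ k = β then z ^ 2 * g s else 0) else 0) := fun c => by
    by_cases h1 : s = c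
    · subst h1
      have h2 : ∀ α, i α ≠ s := fun α => (hsi α).symm
      simp only [h2, if_false, zero_add, and_true, if_true]
      by_cases h3 : k = α
      · by_cases h4 : k = β
        · rw [if_pos h3, if_pos h4, if_pos ⟨h3, h4⟩]
          ring
        · simp [h4]
      · simp [h3]
    · by_cases h2 : i α = c
      · subst h2
        by_cases h3 : α = β
        · subst h3
          simp [h1]
        · have h4 : i β ≠ i α := fun e => h3 (i.injective e).symm
          simp [h1, h3, h4]
      · simp [h1, h2]
  simp only [e, Finset.sum_add_distrib, Finset.sum_ite_eq, Finset.mem_univ, if_true]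
  by_cases h3 : α = β
  · subst h3
    simp
  · have : ¬ (k = α ∧ k = β) := fun h => h3 (h.1.symm.trans h.2)
    simp [h3, this]

theorem axisWeight_pos {g : Fin n → ℝ} (hg : ∀ c, 0 < g c) (i : Fin m ↪o Fin n) (k : Fin m)
    (s : Fin n) (z : ℝ) (α : Fin m) : 0 < g (i α) + if k = α then z ^ 2 * g s else 0 := by
  have h1 := hg (i α)
  have h2 := hg s
  split_ifs <;> positivity

theorem trFun_single_axis {i : Fin m ↪o Fin n} (k : Fin m) {s : Fin n} (hs : s ∉ Set.range i)
    (z : ℝ) : trFun (Pi.single s 1) (chartInv i (axis i k s z)) = z ^ 2 / (1 + z ^ 2) := by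
  have h : trFun (Pi.single s 1) (chartInv i (axis i k s z)) =
    wTrace (Pi.single s 1) (chartMatrix i (axis i k s z)) := rfl
  have hsi : ∀ α, i α ≠ s := fun α e => hs ⟨α, e⟩
  rw [h, chartMatrix_axis k hs, wTrace, wGram_axis _ k hs, wGram_axis _ k hs,
    inv_diagonal_of_pos (axisWeight_pos (g := 1) (fun _ => one_pos) i k s z),
    Matrix.diagonal_mul_diagonal,
    Matrix.trace_diagonal, Finset.sum_eq_single k]
  · simp [hsi]
    ring
  · intro α _ hα
    simp [hsi, hα.symm]
  · simp

/-- Both Gram matrices are diagonal on the axis and only their `k`-th entries depend on `z`; `c`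
collects the other factors. -/
theorem ratio_axis {lam : Fin n → ℝ} (hpos : ∀ k, 0 < lam k) {i : Fin m ↪o Fin n} (k : Fin m)
    {s : Fin n} (hs : s ∉ Set.range i) : ∃ c : ℝ, 0 < c ∧ ∀ z : ℝ,
      ratio lam (selIn i + Matrix.single k s z) =
        c * ((1 + z ^ 2) / (wt lam (i k) + z ^ 2 * wt lam s)) := by
  refine ⟨(∏ α ∈ Finset.univ.erase k, wt lam (i α))⁻¹,
    inv_pos.2 (Finset.prod_pos fun α _ => wt_pos hpos _), fun z => ?_⟩
  rw [ratio, wGram_axis _ k hs, wGram_axis _ k hs, Matrix.det_diagonal, Matrix.det_diagonal,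
    ← Finset.mul_prod_erase _ _ (Finset.mem_univ k),
    ← Finset.mul_prod_erase _ _ (Finset.mem_univ k)]
  have h1 : ∏ α ∈ Finset.univ.erase k,
      ((1 : Fin n → ℝ) (i α) + if k = α then z ^ 2 * (1 : Fin n → ℝ) s else 0) = 1 :=
    Finset.prod_eq_one fun α hα => by simp [(Finset.ne_of_mem_erase hα).symm]
  have h2 : ∏ α ∈ Finset.univ.erase k, (wt lam (i α) + if k = α then z ^ 2 * wt lam s else 0) =
      ∏ α ∈ Finset.univ.erase k, wt lam (i α) :=
    Finset.prod_congr rfl fun α hα => by simp [(Finset.ne_of_mem_erase hα).symm]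
  rw [h1, h2]
  simp only [if_true, Pi.one_apply, mul_one]
  rw [div_mul_eq_div_div_swap, div_eq_inv_mul _ (Finset.prod _ _), mul_div_assoc]

/-- The gradient equation along an axis. -/
theorem gradient_axis {lam : Fin n → ℝ} (hpos : ∀ k, 0 < lam k) {i : Fin m ↪o Fin n} (k : Fin m)
    {s : Fin n} (hs : s ∉ Set.range i) (z : ℝ) :
    ∃ H : Matrix (Fin m) (Fin m) ℝ,
      Matrix.single k s (z * (2 * ratio lam (selIn i + Matrix.single k s z) *
        ((1 + z ^ 2) / (wt lam (i k) + z ^ 2 * wt lam s)) * (wt lam s - wt lam (i k)))) +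
        H * (selIn i + Matrix.single k s z) =
      (2 * ratio lam (selIn i + Matrix.single k s z)) •
        (wGram 1 (selIn i + Matrix.single k s z) *
          (wGram (wt lam) (selIn i + Matrix.single k s z))⁻¹ * (selIn i + Matrix.single k s z) *
          Matrix.diagonal (wt lam)) := by
  have hsi : ∀ α, s ≠ i α := fun α e => hs ⟨α, e.symm⟩
  rw [wGram_axis _ k hs, wGram_axis _ k hs,
    inv_diagonal_of_pos (axisWeight_pos (wt_pos hpos) i k s z),
    Matrix.diagonal_mul_diagonal]
  set r := ratio lam (selIn i + Matrix.single k s z)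
  set b : Fin m → ℝ := fun α =>
    ((1 : Fin n → ℝ) (i α) + if k = α then z ^ 2 * (1 : Fin n → ℝ) s else 0) *
    (wt lam (i α) + if k = α then z ^ 2 * wt lam s else 0)⁻¹ with hb
  -- Forced by the identity columns `i α`, where the velocity has no entry.
  refine ⟨Matrix.diagonal fun α => 2 * r * b α * wt lam (i α), ?_⟩
  ext α c
  rw [Matrix.add_apply, Matrix.diagonal_mul, Matrix.smul_apply, Matrix.mul_diagonal,
    Matrix.diagonal_mul, axisMatrix_apply, Matrix.single_apply, smul_eq_mul]
  by_cases h1 : s = c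
  · subst h1
    by_cases h2 : k = α
    · subst h2
      simp only [(hsi k).symm, and_self, if_true, if_false, hb, Pi.one_apply, mul_one, zero_add,
        div_eq_mul_inv]
      ring
    · simp [(hsi α).symm, h2]
  · simp only [h1, and_false, if_false, add_zero, zero_add]
    by_cases h2 : i α = c
    · subst h2
      simp only [if_true]
      ring
    · simp [h2]

/-- The half axis of direction `σ`, as a set of points of the Grassmannian. -/
def arc (i : Fin m ↪o Fin n) (k : Fin m) (s : Fin n) (σ : ℝ) : Set (Gr m n) :=
  {p | ∃ x : ℝ, 0 < x ∧ chartInv i (axis i k s (σ * x)) = p}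

theorem axis_apply_self (i : Fin m ↪o Fin n) (k : Fin m) {s : Fin n} (hs : s ∉ Set.range i)
    (z : ℝ) : axis i k s z k ⟨s, hs⟩ = z := by
  simp [axis]

theorem chartInv_axis_injective {i : Fin m ↪o Fin n} {k : Fin m} {s : Fin n}
    (hs : s ∉ Set.range i) : Function.Injective fun z => chartInv i (axis i k s z) := by
  intro z w h
  have := congrArg (fun p => chart i p k ⟨s, hs⟩) h
  simpa [chart_chartInv, axis_apply_self] using this

theorem arc_ne {i : Fin m ↪o Fin n} {k : Fin m} {s : Fin n} (hs : s ∉ Set.range i) :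
    arc i k s 1 ≠ arc i k s (-1) := by
  intro h
  have h1 : chartInv i (axis i k s (1 * 1)) ∈ arc i k s 1 := ⟨1, one_pos, rfl⟩
  rw [h] at h1
  obtain ⟨x, hx, e⟩ := h1
  have := chartInv_axis_injective hs e
  linarith

theorem continuous_axis (i : Fin m ↪o Fin n) (k : Fin m) (s : Fin n) : Continuous (axis i k s) := by
  refine continuous_pi fun α => continuous_pi fun c => ?_
  unfold axis
  split_ifs
  · exact continuous_id
  · exact continuous_const

theorem axis_zero (i : Fin m ↪o Fin n) (k : Fin m) (s : Fin n) : axis i k s 0 = 0 := by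
  funext α c
  simp [axis]

section Neighbours

variable {i l : Fin m ↪o Fin n} {k : Fin m}

theorem not_mem_range_of_neighbour (hk : (i k : ℕ) = l k + 1) (hj : ∀ j, j ≠ k → i j = l j) :
    l k ∉ Set.range i := by
  rintro ⟨α, hα⟩
  by_cases h : α = k
  · have := congrArg Fin.val hα
    rw [h] at this
    omega
  · rw [hj α h] at hα
    exact h (l.injective hα)

theorem not_mem_range_of_neighbour' (hk : (i k : ℕ) = l k + 1) (hj : ∀ j, j ≠ k → i j = l j) :
    i k ∉ Set.range l := by
  rintro ⟨α, hα⟩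
  by_cases h : α = k
  · have := congrArg Fin.val hα
    rw [h] at this
    omega
  · rw [← hj α h] at hα
    exact h (i.injective hα)

/-- Change of charts along the common axis. -/
theorem chartInv_axis_eq (hk : (i k : ℕ) = l k + 1) (hj : ∀ j, j ≠ k → i j = l j) {z : ℝ}
    (hz : z ≠ 0) : chartInv l (axis l k (i k) z⁻¹) = chartInv i (axis i k (l k) z) := by
  -- The change of chart multiplies row `k` by `z`, exchanging the roles of the columns `i k` and `l
  -- k`.
  have hdet : (Matrix.diagonal fun α : Fin m => if α = k then z else 1).det ≠ 0 := by
    rw [Matrix.det_diagonal, Finset.prod_ne_zero_iff]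
    intro α _
    split_ifs
    · exact hz
    · exact one_ne_zero
  refine proj_eq_iff.2 ⟨Matrix.GeneralLinearGroup.mkOfDetNeZero _ hdet, ?_⟩
  change chartMatrix i _ = (Matrix.diagonal fun α : Fin m => if α = k then z else 1) *
    chartMatrix l _
  rw [chartMatrix_axis k (not_mem_range_of_neighbour hk hj),
    chartMatrix_axis k (not_mem_range_of_neighbour' hk hj)]
  ext α c
  rw [Matrix.diagonal_mul, axisMatrix_apply, axisMatrix_apply]
  by_cases h : α = k
  · subst h
    simp only [true_and, if_true, mul_add, mul_ite, mul_one, mul_zero, mul_inv_cancel₀ hz]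
    ring
  · have h' : ¬ k = α := fun e => h e.symm
    simp [h, h', hj α h]

theorem exists_flowLine_arc {lam : Fin n → ℝ} (hpos : ∀ k, 0 < lam k) (hlam : StrictMono lam)
    (hk : (i k : ℕ) = l k + 1) (hj : ∀ j, j ≠ k → i j = l j) {σ : ℝ} (hσ : σ ^ 2 = 1) :
    arc i k (l k) σ ∈ trajectories lam (origin i) (origin l) := by
  have hs := not_mem_range_of_neighbour hk hj
  obtain ⟨c, hc, hratio⟩ := ratio_axis hpos k hs
  set s := l k
  set p := wt lam s
  set q := wt lam (i k)
  have hp : 0 < p := wt_pos hpos _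
  have hq : 0 < q := wt_pos hpos _
  have hpq : q < p := wt_strictAnti hpos hlam (Fin.lt_def.2 (by omega))
  have hσ0 : σ ≠ 0 := fun h => by simp [h] at hσ
  -- With `z = σ * exp x` the axis equation becomes `x' = 2 c ρ(x)² (p - q)`, whose right side is
  -- positive and bounded, so the solution is global and sweeps the whole half axis.
  let ρ : ℝ → ℝ := fun x => (1 + Real.exp x ^ 2) / (q + Real.exp x ^ 2 * p)
  have hρ : ∀ x, 0 < ρ x := fun x => by
    have := Real.exp_pos x
    positivity
  have hρle : ∀ x, ρ x ≤ q⁻¹ := fun x => by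
    have := Real.exp_pos x
    rw [div_le_iff₀ (by positivity), mul_add, inv_mul_cancel₀ hq.ne', inv_mul_eq_div,
      mul_div_assoc]
    gcongr
    exact le_mul_of_one_le_right (by positivity) ((one_le_div hq).2 hpq.le)
  have hρc : Continuous ρ := by
    refine Continuous.div (by fun_prop) (by fun_prop) fun x => ?_
    have := Real.exp_pos x
    positivity
  obtain ⟨x, hx, hsurj, htop, hbot⟩ := exists_solution
    (v := fun x => 2 * (c * ρ x) * ρ x * (p - q)) (by fun_prop)
    (fun x => by
      have := hρ x
      have := sub_pos.2 hpq
      positivity)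
    (K := 2 * (c * q⁻¹) * q⁻¹ * (p - q))
    (fun x => by
      have := (hρ x).le
      have := hρle x
      have := (sub_pos.2 hpq).le
      gcongr)
  let z : ℝ → ℝ := fun t => σ * Real.exp (x t)
  have hz0 : ∀ t, z t ≠ 0 := fun t => mul_ne_zero hσ0 (Real.exp_pos _).ne'
  have hz2 : ∀ t, z t ^ 2 = Real.exp (x t) ^ 2 := fun t => by
    simp only [z, mul_pow, hσ, one_mul]
  let X : ℝ → FullRank m n := fun t => ⟨chartMatrix i (axis i k s (z t)), chartMatrix_rank _ _⟩
  have hX : ∀ t, (X t).1 = selIn i + Matrix.single k s (z t) := fun t => chartMatrix_axis k hs _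
  have hzd : ∀ t, HasDerivAt z (z t * (2 * ratio lam (selIn i + Matrix.single k s (z t)) *
      ((1 + z t ^ 2) / (q + z t ^ 2 * p)) * (p - q))) t := fun t => by
    rw [hratio, hz2]
    refine ((hx t).exp.const_mul σ).congr_deriv ?_
    simp only [z, ρ]
    ring
  choose H hH using fun t => gradient_axis hpos k hs (z t)
  have hflow : IsFlowLine lam fun t => proj (X t) := by
    refine isFlowLine_of_matrix hpos (X' := fun t => Matrix.single k s (z t *
      (2 * ratio lam (selIn i + Matrix.single k s (z t)) *
      ((1 + z t ^ 2) / (q + z t ^ 2 * p)) * (p - q)))) (fun t => ?_) (H := H) (fun t => ?_)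
    · have h1 : HasMatDeriv (fun t => Matrix.single k s (z t)) (Matrix.single k s (z t *
          (2 * ratio lam (selIn i + Matrix.single k s (z t)) *
          ((1 + z t ^ 2) / (q + z t ^ 2 * p)) * (p - q)))) t := fun α b => by
        simp only [Matrix.single_apply]
        split_ifs
        · exact hzd t
        · exact hasDerivAt_const _ _
      simp only [hX]
      simpa using (HasMatDeriv.const (selIn i)).add h1
    · rw [hX]
      exact hH t
  refine ⟨fun t => proj (X t), hflow, ?_, ?_, ?_⟩
  · have h1 : Tendsto z atBot (𝓝 0) := by
      simpa using (Real.tendsto_exp_atBot.comp hbot).const_mul σ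
    have h2 := (((continuous_chartInv i).comp (continuous_axis i k s)).tendsto 0).comp h1
    simp only [Function.comp_def, axis_zero] at h2
    exact h2
  -- As `z` leaves the chart `i` at infinity, the coordinate `z⁻¹` of the chart `l` tends to its
  -- origin.
  · have h1 : Tendsto (fun t => (z t)⁻¹) atTop (𝓝 0) := by
      have := (Real.tendsto_exp_atTop.comp htop).inv_tendsto_atTop.const_mul σ⁻¹
      simpa [z, mul_comm, Function.comp_def] using this
    have h2 := (((continuous_chartInv l).comp (continuous_axis l k (i k))).tendsto 0).comp h1
    simp only [Function.comp_def, axis_zero] at h2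
    exact h2.congr fun t => chartInv_axis_eq hk hj (hz0 t)
  · ext y
    constructor
    · rintro ⟨w, hw, rfl⟩
      obtain ⟨t, ht⟩ := hsurj (Real.log w)
      refine ⟨t, ?_⟩
      change chartInv i (axis i k s (σ * Real.exp (x t))) = _
      rw [ht, Real.exp_log hw]
    · rintro ⟨t, rfl⟩
      exact ⟨Real.exp (x t), Real.exp_pos _, rfl⟩

/-! ### Flow lines between neighbours stay on the axis. -/

theorem initInd_succ_sub (c : Fin n) :
    initInd n (c + 1) - initInd n c = Pi.single c 1 := by
  funext a
  simp only [Pi.sub_apply, initInd, Pi.single_apply, Fin.ext_iff]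
  split_ifs <;> first | omega | norm_num

theorem trFun_sub (g h : Fin n → ℝ) (p : Gr m n) : trFun (g - h) p = trFun g p - trFun h p := by
  obtain ⟨X, rfl⟩ := proj_surjective p
  exact wTrace_sub g h X.1

theorem trFun_add (g h : Fin n → ℝ) (p : Gr m n) : trFun (g + h) p = trFun g p + trFun h p := by
  obtain ⟨X, rfl⟩ := proj_surjective p
  exact wTrace_add g h X.1

theorem trFun_single_nonneg (c : Fin n) (p : Gr m n) : 0 ≤ trFun (Pi.single c 1) p := by
  obtain ⟨X, rfl⟩ := proj_surjective p
  rw [trFun_proj, wTrace_single]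
  exact rowProj_diag_nonneg X.2 c

/-- Every flow line between neighbouring critical points runs along one of the two half axes. -/
theorem IsFlowLine.range_eq_arc {lam : Fin n → ℝ} (hpos : ∀ k, 0 < lam k) (hlam : StrictMono lam)
    (hk : (i k : ℕ) = l k + 1) (hj : ∀ j, j ≠ k → i j = l j) {γ : ℝ → Gr m n}
    (hγ : IsFlowLine lam γ) (hi : Tendsto γ atBot (𝓝 (origin i)))
    (hl : Tendsto γ atTop (𝓝 (origin l))) :
    Set.range γ = arc i k (l k) 1 ∨ Set.range γ = arc i k (l k) (-1) := by
  have hs := not_mem_range_of_neighbour hk hj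
  -- Only the threshold `c = l k + 1` separates `l k` from `i k`; for every other one the monotone
  -- trace has equal limits at both ends.
  have hconst : ∀ c : ℕ, c ≠ l k + 1 → ∀ t,
      trFun (initInd n c) (γ t) = trFun (initInd n c) (origin i) := by
    intro c hc t
    have hmono := hγ.monotone_trFun hpos hlam (initInd_antitone n c)
    have h1 := hmono.le_of_tendsto (((continuous_trFun _).tendsto _).comp hi) t
    have h2 := hmono.ge_of_tendsto (((continuous_trFun _).tendsto _).comp hl) t
    have h3 : trFun (initInd n c) (origin i) = trFun (initInd n c) (origin l) := by
      rw [trFun_origin, trFun_origin]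
      refine Finset.sum_congr rfl fun α _ => ?_
      by_cases hα : α = k
      · subst hα
        simp only [initInd]
        split_ifs <;> first | omega | rfl
      · rw [hj α hα]
    exact le_antisymm (h2.trans h3.ge) h1
  have hdiag : ∀ c : Fin n, c ≠ l k → c ≠ i k → ∀ t,
      trFun (Pi.single c 1) (γ t) = trFun (Pi.single c 1) (origin i) := by
    intro c h1 h2 t
    have h1' : (c : ℕ) ≠ l k := fun e => h1 (Fin.ext e)
    have h2' : (c : ℕ) ≠ i k := fun e => h2 (Fin.ext e)
    rw [← initInd_succ_sub, trFun_sub, trFun_sub, hconst _ (by omega), hconst _ (by omega)]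
  set u : ℝ → ℝ := fun t => trFun (Pi.single (l k) 1) (γ t) with hu
  set w : ℝ → ℝ := fun t => trFun (Pi.single (i k) 1) (γ t) with hw
  have horig : ∀ c : Fin n, ∀ a : Fin m ↪o Fin n,
      trFun (Pi.single c 1) (origin a) = ∑ α, if a α = c then 1 else 0 := fun c a => by
    rw [trFun_origin]
    simp only [Pi.single_apply]
  have hmem1 : ∀ (a : Fin m ↪o Fin n) α, trFun (Pi.single (a α) 1) (origin a) = 1 := fun a α => by
    rw [horig, Finset.sum_eq_single α] <;> simp
  have hmem0 : ∀ (a : Fin m ↪o Fin n) c, c ∉ Set.range a →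
      trFun (Pi.single c 1) (origin a) = 0 := fun a c hc => by
    rw [horig]
    exact Finset.sum_eq_zero fun α _ => if_neg fun e => hc ⟨α, e⟩
  have huw : ∀ t, u t + w t = 1 := by
    intro t
    have e : initInd n (l k + 2) - initInd n (l k) =
        (Pi.single (l k) 1 + Pi.single (i k) 1 : Fin n → ℝ) := by
      funext a
      simp only [Pi.sub_apply, Pi.add_apply, initInd, Pi.single_apply, Fin.ext_iff, hk]
      split_ifs <;> first | omega | norm_num
    have h1 : u t + w t = trFun (Pi.single (l k) 1 + Pi.single (i k) 1) (origin i) := by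
      simp only [hu, hw]
      rw [← trFun_add, ← e, trFun_sub, trFun_sub, hconst _ (by omega), hconst _ (by omega)]
    rw [h1, trFun_add, hmem1, hmem0 i _ hs, zero_add]
  choose Y hY hd using hγ.hasDerivAt_trFun hpos
  obtain ⟨K, hK0, hK⟩ := exists_flowRate_bound hpos m
  have hsingle : ∀ c : Fin n, ∀ b, (0 : ℝ) ≤ (Pi.single c 1 : Fin n → ℝ) b := fun c b => by
    rw [Pi.single_apply]
    split_ifs <;> norm_num
  have hbound : ∀ c t, |flowRate lam (Pi.single c 1) (Y t).1| ≤ K * trFun (Pi.single c 1) (γ t) :=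
    fun c t => by
      have := hK (Pi.single c 1) (hsingle c) (Y t).1 (Y t).2
      rwa [← trFun_proj, hY] at this
  have hulim : Tendsto u atTop (𝓝 1) := by
    rw [← hmem1 l k]
    exact ((continuous_trFun _).tendsto _).comp hl
  have hulim' : Tendsto u atBot (𝓝 0) := by
    rw [← hmem0 i _ hs]
    exact ((continuous_trFun _).tendsto _).comp hi
  have hwlim : Tendsto w atBot (𝓝 1) := by
    rw [← hmem1 i k]
    exact ((continuous_trFun _).tendsto _).comp hi
  have hupos : ∀ t, 0 < u t := pos_of_deriv_le (fun t => trFun_single_nonneg _ _)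
    (fun t => hd t (Pi.single (l k) 1)) (fun t => (le_abs_self _).trans (hbound _ t)) hulim
  -- The same Grönwall argument under time reversal, since `w` tends to 1 at `-∞`.
  have hwpos : ∀ t, 0 < w t := fun t => by
    have h := pos_of_deriv_le (u := fun t => w (-t))
      (u' := fun t => -flowRate lam (Pi.single (i k) 1) (Y (-t)).1) (K := K)
      (fun t => trFun_single_nonneg _ _)
      (fun t => by
        have h1 := (hd (-t) (Pi.single (i k) 1)).scomp t (hasDerivAt_neg t)
        simpa [Function.comp_def] using h1)
      (fun t => (neg_le_abs _).trans (hbound _ (-t))) (hwlim.comp tendsto_neg_atTop_atBot) (-t)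
    simpa using h
  set z : ℝ → ℝ := fun t => chart i (γ t) k ⟨l k, hs⟩ with hz
  have haxis : ∀ t, γ t = chartInv i (axis i k (l k) (z t)) := by
    intro t
    obtain ⟨X, hX⟩ := proj_surjective (γ t)
    have hP : ∀ c, trFun (Pi.single c 1) (γ t) = rowProj X.1 c c := fun c => by
      rw [← hX, trFun_proj, wTrace_single]
    have := exists_eq_axis (k := k) hs X
      (fun α hα => by
        rw [← hP, hdiag (i α) (fun e => hs ⟨α, e⟩) (fun e => hα (i.injective e)), hmem1])
      (fun c hc hcs => by
        rw [← hP, hdiag c hcs (fun e => hc ⟨k, e.symm⟩), hmem0 i c hc])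
      (by rw [← hP]; exact (hwpos t).ne')
      (by
        rw [← hP]
        have h1 := huw t
        have h2 := hwpos t
        have h3 : u t < 1 := by linarith
        exact h3.ne)
    rw [hX] at this
    exact this
  have huz : ∀ t, u t = z t ^ 2 / (1 + z t ^ 2) := fun t => by
    simp only [hu]
    rw [haxis t, trFun_single_axis k hs]
  have hz0 : ∀ t, z t ≠ 0 := fun t h => by
    have := hupos t
    rw [huz, h] at this
    norm_num at this
  have hzc : Continuous z := continuous_iff_continuousAt.2 fun t => by
    obtain ⟨W, -, hW⟩ := hγ.2 t i ⟨_, (haxis t).symm⟩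
    have h1 := hasDerivAt_pi.1 (hasDerivAt_pi.1 hW k) ⟨l k, hs⟩
    exact h1.continuousAt
  have huc : Continuous u := (continuous_trFun _).comp hγ.1
  -- `u = z² / (1 + z²)` runs continuously from 0 to 1, so every positive value of `z²` is attained.
  have hsurj : ∀ y : ℝ, 0 < y → ∃ t, z t ^ 2 = y ^ 2 := by
    intro y hy
    have h1 : 0 < y ^ 2 / (1 + y ^ 2) := by positivity
    have h2 : y ^ 2 / (1 + y ^ 2) < 1 := by
      rw [div_lt_one (by positivity)]
      linarith
    obtain ⟨a, ha⟩ := (hulim'.eventually (eventually_lt_nhds h1)).exists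
    obtain ⟨b, hb⟩ := (hulim.eventually (eventually_gt_nhds h2)).exists
    obtain ⟨t, ht⟩ := mem_range_of_exists_le_of_exists_ge huc ⟨a, ha.le⟩ ⟨b, hb.le⟩
    refine ⟨t, ?_⟩
    rw [huz, div_eq_div_iff (by positivity) (by positivity)] at ht
    linarith
  have hrange : ∀ σ : ℝ, σ ^ 2 = 1 → (∀ t, 0 < σ * z t) → Set.range γ = arc i k (l k) σ := by
    intro σ hσ hsign
    have hσσ : ∀ y, σ * (σ * y) = y := fun y => by rw [← mul_assoc, ← pow_two, hσ, one_mul]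
    ext p
    constructor
    · rintro ⟨t, rfl⟩
      refine ⟨σ * z t, hsign t, ?_⟩
      rw [hσσ, ← haxis]
    · rintro ⟨y, hy, rfl⟩
      obtain ⟨t, ht⟩ := hsurj y hy
      have h1 : σ * z t = y := by
        refine (sq_eq_sq₀ (hsign t).le hy.le).1 ?_
        rw [mul_pow, hσ, one_mul, ht]
      refine ⟨t, ?_⟩
      rw [haxis t, ← h1, hσσ]
  by_cases hsgn : ∀ t, 0 < z t
  · exact Or.inl (hrange 1 (by norm_num) fun t => by simpa using hsgn t)
  -- The coordinate `z` is continuous and never zero, so it has constant sign.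
  · refine Or.inr (hrange (-1) (by norm_num) fun t => ?_)
    push Not at hsgn
    obtain ⟨a, ha⟩ := hsgn
    by_contra! h
    obtain ⟨b, hb⟩ := mem_range_of_exists_le_of_exists_ge (c := 0) hzc ⟨a, ha⟩ ⟨t, by linarith⟩
    exact hz0 b hb

theorem trajectories_eq_pair {lam : Fin n → ℝ} (hpos : ∀ k, 0 < lam k) (hlam : StrictMono lam)
    (hk : (i k : ℕ) = l k + 1) (hj : ∀ j, j ≠ k → i j = l j) :
    trajectories lam (origin i) (origin l) = {arc i k (l k) 1, arc i k (l k) (-1)} := by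
  ext C
  simp only [Set.mem_insert_iff, Set.mem_singleton_iff]
  constructor
  · rintro ⟨γ, hγ, hi, hl, rfl⟩
    exact hγ.range_eq_arc hpos hlam hk hj hi hl
  · rintro (rfl | rfl)
    · exact exists_flowLine_arc hpos hlam hk hj (by norm_num)
    · exact exists_flowLine_arc hpos hlam hk hj (by norm_num)

end Neighbours

end RealGrassmann

end

/-! ### The count of trajectories. -/

theorem mainTheorem3 {m n : ℕ} (lam : Fin n → ℝ) (hpos : ∀ k, 0 < lam k) (hlam : StrictMono lam)
    (i l : Fin m ↪o Fin n)
    (hind : (RealGrassmann.morseIndex lam i (RealGrassmann.origin i) : ℤ)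
      - RealGrassmann.morseIndex lam l (RealGrassmann.origin l) = 1) :
    ((∃ k, (i k : ℕ) = l k + 1 ∧ ∀ j, j ≠ k → i j = l j) →
      (RealGrassmann.trajectories lam (RealGrassmann.origin i)
        (RealGrassmann.origin l)).encard = 2) ∧
    ((¬ ∃ k, (i k : ℕ) = l k + 1 ∧ ∀ j, j ≠ k → i j = l j) →
      (RealGrassmann.trajectories lam (RealGrassmann.origin i)
        (RealGrassmann.origin l)).encard = 0) := by
  constructor
  · rintro ⟨k, hk, hj⟩
    rw [RealGrassmann.trajectories_eq_pair hpos hlam hk hj]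
    exact Set.encard_pair (RealGrassmann.arc_ne (RealGrassmann.not_mem_range_of_neighbour hk hj))
  · intro h
    rw [Set.encard_eq_zero, Set.eq_empty_iff_forall_notMem]
    rintro C ⟨γ, hγ, hi, hl, -⟩
    -- The term `∑ α` in the index formula is common to `i` and `l`, so the index difference is the
    -- difference of the sums of their entries.
    refine h (RealGrassmann.exists_eq_add_one_of_sum (hγ.le_of_tendsto hpos hlam hi hl) ?_)
    have h1 := RealGrassmann.morseIndex_origin hpos hlam i
    have h2 := RealGrassmann.morseIndex_origin hpos hlam l
    omega
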